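/- Let $n\ge 1$. On $\mathbb R^{2n}$ with coordinates $(q,p)$ let $\pi=\sum_{i=1}^n\partial_{p_i}\wedge\partial_{q_i}$, where for a bivector $P$ the map $P^\sharp$ is defined by $\langle\beta,P^\sharp\alpha\rangle=P(\alpha,\beta)$. Let $$N=\sum_{i=1}^{n}p_i\left(\partial_{q_i}\otimes dq_i+\partial_{p_i}\otimes dp_i\right)+\sum_{i<j}\left(\partial_{q_i}\otimes dp_j-\partial_{q_j}\otimes dp_i\right)+\sum_{i=1}^{n-1}e^{q_i-q_{i+1}}\left(\partial_{p_{i+1}}\otimes dq_i-\partial_{p_i}\otimes dq_{i+1}\right),$$ $\Omega=e^{q_n-q_1}\,dq_n\wedge dq_1$, $\Omega^\flat(X)=i_X\Omega$, $N_\pm=N\pm\pi^\sharp\Omega^\flat$, $\pi_{N_-}^\sharp=N_-\pi^\sharp$, $H_k^+=\frac1{2k}\operatorname{Tr}(N_+^k)$, $f_k=-\operatorname{Tr}(N_+^{k-1}\pi^\sharp\Omega^\flat)$ for $k\ge1$, and $X_1=\sum_i\partial_{q_i}$. Let $F:\mathbb R^{2n}\to\mathbb R^{2n}$, $F(q,p)=(a,b)$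 with $a_i=-e^{q_i-q_{i+1}}$, $b_i=p_i$, $q_{n+1}=q_1$, be the Flaschka map. With indices taken modulo $n$, let $$P_0=\sum_{i=1}^n a_i(\partial_{b_i}-\partial_{b_{i+1}})\wedge\partial_{a_i},$$ $$P_1=\sum_{i=1}^n\Big(a_ia_{i+1}\,\partial_{a_i}\wedge\partial_{a_{i+1}}+a_i(b_i\partial_{b_i}-b_{i+1}\partial_{b_{i+1}})\wedge\partial_{a_i}+a_i\,\partial_{b_{i+1}}\wedge\partial_{b_i}\Big).$$ Let $C=\prod_{i}a_i$ and $\widetilde{\mathcal M}=\{(a,b)\mid C(a,b)=(-1)^n,\ a_i<0 \text{ for all } i\}$. Then: 1. $P_0$ and $P_1$ are compatible Poisson bivectors on $\mathbb R^{2n}$, and $C$ is a Casimir function of both. 2. $\widetilde{\mathcal M}$ is a regular level hypersurface ($dC\ne0$ and $T\widetilde{\mathcal M}=\ker dC$ along it), $F$ is a surjective submersion $\mathbb R^{2n}\to\widetilde{\mathcal M}$, and its fibres are the integral curves of $X_1$. 3. $\pi_{N_-}$ is a bivector (i.e. skew-symmetric), and $P_0^\sharp=F_*\pi^\sharp F^*$,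 $P_1^\sharp=F_*\pi_{N_-}^\sharp F^*$ along $F$. 4. $P_0,P_1$ restrict to bivector fields $\widetilde P_0,\widetilde P_1$ on $\widetilde{\mathcal M}$; the triple $(\mathbb R^{2n},\pi,\pi_{N_-})$ projects through $F$ onto $(\widetilde{\mathcal M},\widetilde P_0,\widetilde P_1)$; and $\widetilde P_0,\widetilde P_1$ are compatible Poisson bivectors. 5. For all $k\ge1$ the $H_k^+$ are smooth and satisfy the generalized Lenard–Magri relations $N_-^*dH_k^+=dH_{k+1}^++f_k\,dH_1^+$ on $\mathbb R^{2n}$. Moreover $\pi^\sharp dH_1^+=X_1$, and $\pi_{N_-}^\sharp dH_k^+=\pi^\sharp dH_{k+1}^++f_kX_1$. 6. For all $k\ge 1$ there are smooth functions $\widetilde H_k^+$ on $\widetilde{\mathcal M}$ with $H_k^+=\widetilde H_k^+\circ F$. They satisfy $\widetilde P_0^\sharp d\widetilde H_1^+=0$ and $\widetilde P_1^\sharp d\widetilde H_k^+=\widetilde P_0^\sharp d\widetilde H_{k+1}^+$ for all $k\ge1$. -/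

import Mathlib

open scoped ContDiff

namespace Toda

noncomputable section

/-! ### Bivector fields and Poisson structures on a vector space `E` -/

section Ambient

variable {E : Type*} [NormedAddCommGroup E] [NormedSpace ℝ E]

/-- A field of bivectors `P` on `E`, given through the associated maps `P_x^♯ : T_x^* → T_x`
with `⟨β, P_x^♯ α⟩ = P_x(α, β)`; skew-symmetry and smoothness are asked for in `IsPoisson`. -/
abbrev BivectorField (E : Type*) [NormedAddCommGroup E] [NormedSpace ℝ E] : Type _ :=
  E → (E →L[ℝ] ℝ) →L[ℝ] E

/-- The map `♯` of the decomposable bivector `u ∧ v`: `(u ∧ v)^♯ α = α(u) v - α(v) u`. -/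
def wedge (u v : E) : (E →L[ℝ] ℝ) →L[ℝ] E :=
  (ContinuousLinearMap.apply ℝ ℝ u).smulRight v - (ContinuousLinearMap.apply ℝ ℝ v).smulRight u

/-- `P(α, β) = - P(β, α)` at every point. -/
def IsSkew (P : BivectorField E) : Prop :=
  ∀ (x : E) (α β : E →L[ℝ] ℝ), β (P x α) = -α (P x β)

/-- The bracket `{f, g} = P(df, dg) = ⟨dg, P^♯ df⟩`. -/
def bracket (P : BivectorField E) (f g : E → ℝ) : E → ℝ :=
  fun x => fderiv ℝ g x (P x (fderiv ℝ f x))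

/-- `P` is a (smooth) Poisson bivector field on `E`. -/
structure IsPoisson (P : BivectorField E) : Prop where
  skew : IsSkew P
  smooth : ∀ f g : E → ℝ, ContDiff ℝ ∞ f → ContDiff ℝ ∞ g → ContDiff ℝ ∞ (bracket P f g)
  jacobi : ∀ f g h : E → ℝ, ContDiff ℝ ∞ f → ContDiff ℝ ∞ g → ContDiff ℝ ∞ h → ∀ x : E,
    bracket P f (bracket P g h) x + bracket P g (bracket P h f) x
      + bracket P h (bracket P f g) x = 0

/-- `P` and `Q` are compatible Poisson bivectors: the whole pencil `P + c Q` is Poisson. -/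
structure IsBiHamiltonian (P Q : BivectorField E) : Prop where
  left : IsPoisson P
  right : IsPoisson Q
  compatible : ∀ c : ℝ, IsPoisson (fun x => P x + c • Q x)

end Ambient

/-! ### The same notions on an embedded submanifold `M` of `E`

A function on `M` is represented by a function on `E`, of which only the values on `M` matter;
in the same way only the values of a bivector field at the points of `M` matter. -/

section Submanifold

variable {E : Type*} [NormedAddCommGroup E] [NormedSpace ℝ E]

/-- The tangent space `T_x M`, as a subspace of `E`. -/
def tangent (M : Set E) (x : E) : Submodule ℝ E :=
  Submodule.span ℝ (tangentConeAt ℝ M x)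

/-- `f` is a smooth function on `M`: locally the restriction of a smooth function. -/
def SmoothOn (M : Set E) (f : E → ℝ) : Prop :=
  ∀ x ∈ M, ∃ U : Set E, IsOpen U ∧ x ∈ U ∧
    ∃ g : E → ℝ, ContDiffOn ℝ ∞ g U ∧ ∀ y ∈ M ∩ U, g y = f y

/-- The differential at `x` of the function `f` on `M`, a linear form on `T_x M`.
All derivatives of `f` within `M` at `x` agree on `T_x M`, so that the choice made by
`fderivWithin` does not matter. -/
def dOn (M : Set E) (f : E → ℝ) (x : E) : tangent M x →L[ℝ] ℝ :=
  (fderivWithin ℝ f M x).comp (tangent M x).subtypeL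

/-- A field of bivectors on `M`, given through the maps `P_x^♯ : T_x^* M → T_x M`. -/
abbrev BivectorFieldOn (M : Set E) : Type _ :=
  ∀ x : E, (tangent M x →L[ℝ] ℝ) →L[ℝ] tangent M x

/-- The bracket `{f, g} = P(df, dg)` of functions on `M`. -/
def bracketOn (M : Set E) (P : BivectorFieldOn M) (f g : E → ℝ) : E → ℝ :=
  fun x => dOn M g x (P x (dOn M f x))

/-- `P` is a (smooth) Poisson bivector field on `M`. -/
structure IsPoissonOn (M : Set E) (P : BivectorFieldOn M) : Prop where
  skew : ∀ x ∈ M, ∀ α β : tangent M x →L[ℝ] ℝ, β (P x α) = -α (P x β)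
  smooth : ∀ f g : E → ℝ, SmoothOn M f → SmoothOn M g → SmoothOn M (bracketOn M P f g)
  jacobi : ∀ f g h : E → ℝ, SmoothOn M f → SmoothOn M g → SmoothOn M h → ∀ x ∈ M,
    bracketOn M P f (bracketOn M P g h) x + bracketOn M P g (bracketOn M P h f) x
      + bracketOn M P h (bracketOn M P f g) x = 0

/-- `P` and `Q` are compatible Poisson bivectors on `M`. -/
structure IsBiHamiltonianOn (M : Set E) (P Q : BivectorFieldOn M) : Prop where
  left : IsPoissonOn M P
  right : IsPoissonOn M Q
  compatible : ∀ c : ℝ, IsPoissonOn M (fun x => P x + c • Q x)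

/-- `Pt` is the restriction to `M` of the bivector field `P` of the ambient space: `P_x^♯` takes
its values in `T_x M` at the points of `M`, and `Pt_x^♯ (α|_{T_x M}) = P_x^♯ α`. -/
def IsRestriction (M : Set E) (P : BivectorField E) (Pt : BivectorFieldOn M) : Prop :=
  ∀ x ∈ M, ∀ α : E →L[ℝ] ℝ, (Pt x (α.comp (tangent M x).subtypeL) : E) = P x α

/-- The bivector fields `Q` and `P` on `E` are `F`-related: `P = F_* Q F^*`. -/
def FRelated (F : E → E) (Q P : BivectorField E) : Prop :=
  ∀ (x : E) (α : E →L[ℝ] ℝ), fderiv ℝ F x (Q x (α.comp (fderiv ℝ F x))) = P (F x) α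

/-- The bivector field `Q` on `E` projects, through the smooth map `F : E → M`, onto the bivector
field `P` on `M`: the image of `F` is `M`, its tangent map goes to `T M`, and
`P = F_* Q F^*`. -/
def ProjectsTo (F : E → E) (M : Set E) (Q : BivectorField E) (P : BivectorFieldOn M) : Prop :=
  ContDiff ℝ ∞ F ∧ Set.range F = M ∧
    ∀ x : E, ∃ hF : ∀ v : E, fderiv ℝ F x v ∈ tangent M (F x),
      ∀ α : tangent M (F x) →L[ℝ] ℝ,
        (P (F x) α : E) =
          fderiv ℝ F x (Q x (α.comp ((fderiv ℝ F x).codRestrict (tangent M (F x)) hF)))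

end Submanifold

/-! ### The closed Toda lattice in physical variables -/

/-- `ℝ^{2n}`, with points `(q, p)`, or `(a, b)` for the Flaschka coordinates. -/
abbrev Phase (n : ℕ) : Type := (Fin n → ℝ) × (Fin n → ℝ)

section Coordinates

variable {n : ℕ}

/-- The coordinate vector field `∂_{q_i}` (or `∂_{a_i}`). -/
def e₁ (i : Fin n) : Phase n := (Pi.single i 1, 0)

/-- The coordinate vector field `∂_{p_i}` (or `∂_{b_i}`). -/
def e₂ (i : Fin n) : Phase n := (0, Pi.single i 1)

/-- The coordinate 1-form `dq_i`. -/
def dq (i : Fin n) : Phase n →L[ℝ] ℝ :=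
  (ContinuousLinearMap.proj i).comp (ContinuousLinearMap.fst ℝ (Fin n → ℝ) (Fin n → ℝ))

/-- The coordinate 1-form `dp_i`. -/
def dp (i : Fin n) : Phase n →L[ℝ] ℝ :=
  (ContinuousLinearMap.proj i).comp (ContinuousLinearMap.snd ℝ (Fin n → ℝ) (Fin n → ℝ))

/-- `u ⊗ α`, the endomorphism `v ↦ α(v) u`. -/
def tens (u : Phase n) (α : Phase n →L[ℝ] ℝ) : Phase n →L[ℝ] Phase n := α.smulRight u

end Coordinates

/-- The last index of `Fin n`. -/
def lastIndex (n : ℕ) [NeZero n] : Fin n := ⟨n - 1, Nat.sub_lt (NeZero.pos n) Nat.one_pos⟩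

/-- The canonical Poisson tensor `π = ∑ ∂_{p_i} ∧ ∂_{q_i}`. -/
def canonicalPi (n : ℕ) : BivectorField (Phase n) :=
  fun _ => ∑ i : Fin n, wedge (e₂ i) (e₁ i)

/-- The Das-Okubo recursion operator `N` of the open Toda lattice, at the point `x = (q, p)`. -/
def openN (n : ℕ) (x : Phase n) : Phase n →L[ℝ] Phase n :=
  ∑ i : Fin n, x.2 i • (tens (e₁ i) (dq i) + tens (e₂ i) (dp i))
    + ∑ i : Fin n, ∑ j : Fin n,
        (if i < j then tens (e₁ i) (dp j) - tens (e₁ j) (dp i) else 0)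
    + ∑ i : Fin n, ∑ j : Fin n,
        (if (i : ℕ) + 1 = (j : ℕ) then
          Real.exp (x.1 i - x.1 j) • (tens (e₂ j) (dq i) - tens (e₂ i) (dq j)) else 0)

/-- `Ω^♭(X) = i_X Ω` for the 2-form `Ω = e^{q_n - q_1} dq_n ∧ dq_1`. -/
def omegaFlat (n : ℕ) [NeZero n] (x : Phase n) : Phase n →L[ℝ] (Phase n →L[ℝ] ℝ) :=
  Real.exp (x.1 (lastIndex n) - x.1 0) •
    ((dq (lastIndex n)).smulRight (dq (0 : Fin n)) - (dq (0 : Fin n)).smulRight (dq (lastIndex n)))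

/-- `π^♯ Ω^♭`. -/
def piOmega (n : ℕ) [NeZero n] (x : Phase n) : Phase n →L[ℝ] Phase n :=
  (canonicalPi n x).comp (omegaFlat n x)

/-- `N_+ = N + π^♯ Ω^♭`. -/
def Nplus (n : ℕ) [NeZero n] (x : Phase n) : Phase n →L[ℝ] Phase n := openN n x + piOmega n x

/-- `N_- = N - π^♯ Ω^♭`. -/
def Nminus (n : ℕ) [NeZero n] (x : Phase n) : Phase n →L[ℝ] Phase n := openN n x - piOmega n x

/-- `π_{N_-}`, defined by `π_{N_-}^♯ = N_- π^♯`. -/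
def piNminus (n : ℕ) [NeZero n] : BivectorField (Phase n) :=
  fun x => (Nminus n x).comp (canonicalPi n x)

/-- `H_k^+ = (1 / 2k) Tr (N_+^k)`, for `k ≥ 1`. -/
def Hplus (n : ℕ) [NeZero n] (k : ℕ) (x : Phase n) : ℝ :=
  1 / (2 * (k : ℝ)) *
    LinearMap.trace ℝ (Phase n) (((Nplus n x) ^ k : Phase n →L[ℝ] Phase n) : Phase n →ₗ[ℝ] Phase n)

/-- `f_k = - Tr (N_+^{k-1} π^♯ Ω^♭)`, for `k ≥ 1`. -/
def fcoef (n : ℕ) [NeZero n] (k : ℕ) (x : Phase n) : ℝ :=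
  -LinearMap.trace ℝ (Phase n)
    ((((Nplus n x) ^ (k - 1)).comp (piOmega n x) : Phase n →L[ℝ] Phase n) :
      Phase n →ₗ[ℝ] Phase n)

/-- `X_1 = ∑ ∂_{q_i}`. -/
def X₁ (n : ℕ) : Phase n := ∑ i : Fin n, e₁ i

/-! ### Flaschka coordinates; indices are cyclic, i.e. `i + 1` is taken modulo `n` -/

/-- The Flaschka map `a_i = - e^{q_i - q_{i+1}}`, `b_i = p_i`, with `q_{n+1} = q_1`. -/
def flaschka (n : ℕ) [NeZero n] (x : Phase n) : Phase n :=
  (fun i => -Real.exp (x.1 i - x.1 (i + 1)), x.2)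

/-- `P_0 = ∑ a_i (∂_{b_i} - ∂_{b_{i+1}}) ∧ ∂_{a_i}`. -/
def P₀ (n : ℕ) [NeZero n] : BivectorField (Phase n) :=
  fun y => ∑ i : Fin n, y.1 i • wedge (e₂ i - e₂ (i + 1)) (e₁ i)

/-- `P_1 = ∑ (a_i a_{i+1} ∂_{a_i} ∧ ∂_{a_{i+1}} + a_i (b_i ∂_{b_i} - b_{i+1} ∂_{b_{i+1}}) ∧ ∂_{a_i}
  + a_i ∂_{b_{i+1}} ∧ ∂_{b_i})`. -/
def P₁ (n : ℕ) [NeZero n] : BivectorField (Phase n) :=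
  fun y => ∑ i : Fin n,
    ((y.1 i * y.1 (i + 1)) • wedge (e₁ i) (e₁ (i + 1))
      + y.1 i • wedge (y.2 i • e₂ i - y.2 (i + 1) • e₂ (i + 1)) (e₁ i)
      + y.1 i • wedge (e₂ (i + 1)) (e₂ i))

/-- `C(a, b) = ∏ a_i`. -/
def casimir (n : ℕ) (y : Phase n) : ℝ := ∏ i : Fin n, y.1 i

/-- `{(a, b) | ∏ a_i = (-1)^n, a_i < 0}`. -/
def levelSet (n : ℕ) : Set (Phase n) :=
  {y | casimir n y = (-1) ^ n ∧ ∀ i, y.1 i < 0}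

end

end Toda

open Toda

set_option maxSynthPendingDepth 3

namespace Toda

/-! ### Poisson calculus on a vector space, restriction to a subset and projection along a map. -/

section General

variable {E : Type*} [NormedAddCommGroup E] [NormedSpace ℝ E]

/-! On the Flaschka side the whole pencil `s P₀ + t P₁` is treated at once. Its Jacobiator, a
first-order expression in the coefficients, is a sum over the cycle of differences `S (i + 1) - S
i`, hence zero (`pencil_schouten`). `C` is a Casimir because `a_i ∂C/∂a_i = C` for every `i`, and
this makes the pencil tangent to the level set, to which it then restricts.

On the physical side put `N_s = N + s π^♯ Ω^♭`. The 2-form `Ω` supplies the link from `n` back to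
`1`, with coefficient `-s e^{q_n - q_1}`. For `s = -1` all links have the same form, so `N_- π^♯` is
`F`-related to the cyclic `P₁`. For `s = 1` the torsion of `N_+` does not vanish, but it consists
only of terms in `X₁` and `π^♯ Ω^♭` (`torsion_twistedN`). Multiply it by `N_+^k` and take the trace:
cyclicity removes the commutator part. Replacing `N_+ v` by `N_- v = N_+ v - 2 π^♯ Ω^♭ v` cancels
everything else except the multiple `f_k` of `dH_1^+`. The cancellation rests on the skewness of
every `N_+^m π^♯` (`sumDp_twistedN_pow`, `traceL_recursion`).

Finally `π^♯ dH_1^+ = X₁` spans the kernel of `dF`, so the anomalous term `f_k X₁` disappears under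
projection and the reduced functions satisfy the standard Lenard–Magri relations. Tangent spaces of
the level set are found from `im dF ⊆ TM ⊆ ker dC ⊆ im dF`. -/

lemma contDiff_bracket {P : BivectorField E} (hP : ContDiff ℝ ∞ P) {f g : E → ℝ}
    (hf : ContDiff ℝ ∞ f) (hg : ContDiff ℝ ∞ g) : ContDiff ℝ ∞ (bracket P f g) := by
  have h1 : ContDiff ℝ ∞ (fderiv ℝ f) := hf.fderiv_right (m := ∞) le_rfl
  have h2 : ContDiff ℝ ∞ (fderiv ℝ g) := hg.fderiv_right (m := ∞) le_rfl
  exact h2.clm_apply (hP.clm_apply h1)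

lemma fderiv_bracket_apply {P : BivectorField E} (hP : ContDiff ℝ ∞ P) {f g : E → ℝ}
    (hf : ContDiff ℝ ∞ f) (hg : ContDiff ℝ ∞ g) (x v : E) :
    fderiv ℝ (bracket P f g) x v = fderiv ℝ (fderiv ℝ g) x v (P x (fderiv ℝ f x))
      + fderiv ℝ g x (fderiv ℝ P x v (fderiv ℝ f x))
      + fderiv ℝ g x (P x (fderiv ℝ (fderiv ℝ f) x v)) := by
  have h1 : DifferentiableAt ℝ (fderiv ℝ f) x :=
    ((hf.fderiv_right (m := ∞) le_rfl).differentiable (by simp)) x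
  have h2 : DifferentiableAt ℝ (fderiv ℝ g) x :=
    ((hg.fderiv_right (m := ∞) le_rfl).differentiable (by simp)) x
  have h3 : DifferentiableAt ℝ P x := (hP.differentiable (by simp)) x
  have h := h2.hasFDerivAt.clm_apply (h3.hasFDerivAt.clm_apply h1.hasFDerivAt)
  have h' : fderiv ℝ (bracket P f g) x = _ := h.fderiv
  rw [h']
  simp
  ring

/-- The Jacobi identity of a smooth field of bivectors is a pointwise condition on its first
derivatives. -/
theorem isPoisson_of_schouten {P : BivectorField E} (hs : IsSkew P) (hP : ContDiff ℝ ∞ P)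
    (hJ : ∀ (x : E) (α β γ : E →L[ℝ] ℝ), γ (fderiv ℝ P x (P x α) β) + α (fderiv ℝ P x (P x β) γ)
      + β (fderiv ℝ P x (P x γ) α) = 0) : IsPoisson P where
  skew := hs
  smooth f g hf hg := contDiff_bracket hP hf hg
  jacobi f g h hf hg hh x := by
    -- Skewness turns the term containing the Hessian of `v` into that Hessian on two Hamiltonian
    -- vectors. In the cyclic sum each Hessian then occurs twice with opposite signs and swapped
    -- arguments, so symmetry cancels them.
    have key : ∀ u v w : E → ℝ, ContDiff ℝ ∞ u → ContDiff ℝ ∞ v → ContDiff ℝ ∞ w →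
        bracket P u (bracket P v w) x =
          fderiv ℝ (fderiv ℝ w) x (P x (fderiv ℝ u x)) (P x (fderiv ℝ v x))
          + fderiv ℝ w x (fderiv ℝ P x (P x (fderiv ℝ u x)) (fderiv ℝ v x))
          - fderiv ℝ (fderiv ℝ v) x (P x (fderiv ℝ u x)) (P x (fderiv ℝ w x)) := by
      intro u v w _ hv hw
      rw [bracket, fderiv_bracket_apply hP hv hw, hs x _ (fderiv ℝ w x)]
      ring
    have sym : ∀ u : E → ℝ, ContDiff ℝ ∞ u → ∀ v w,
        fderiv ℝ (fderiv ℝ u) x v w = fderiv ℝ (fderiv ℝ u) x w v := by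
      intro u hu v w
      exact (hu.contDiffAt.isSymmSndFDerivAt (by
        rw [minSmoothness_of_isRCLikeNormedField]; exact WithTop.coe_le_coe.2 le_top)).eq v w
    rw [key f g h hf hg hh, key g h f hg hh hf, key h f g hh hf hg]
    rw [sym f hf (P x (fderiv ℝ g x)), sym g hg (P x (fderiv ℝ h x)),
      sym h hh (P x (fderiv ℝ f x))]
    linarith [hJ x (fderiv ℝ f x) (fderiv ℝ g x) (fderiv ℝ h x)]

lemma wedge_apply (u v : E) (α : E →L[ℝ] ℝ) : wedge u v α = α u • v - α v • u := by
  simp [wedge]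

lemma apply_mem_tangent {f : E → E} {f' : E →L[ℝ] E} {M : Set E} {x : E}
    (h : HasFDerivAt f f' x) (hM : Set.range f ⊆ M) (v : E) : f' v ∈ tangent M (f x) := by
  have h1 := (hasFDerivWithinAt_univ.2 h).mapsTo_tangent_cone
    (show v ∈ tangentConeAt ℝ Set.univ x by simp)
  rw [Set.image_univ] at h1
  exact Submodule.subset_span (tangentConeAt_mono hM h1)

/-- The differential of a function that is constant on `M` vanishes on `T M`. -/
lemma tangent_le_ker {f : E → ℝ} {f' : E →L[ℝ] ℝ} {M : Set E} {x : E} {c : ℝ}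
    (h : HasFDerivAt f f' x) (hM : ∀ y ∈ M, f y = c) (hx : x ∈ M) :
    tangent M x ≤ LinearMap.ker (f' : E →ₗ[ℝ] ℝ) := by
  refine Submodule.span_le.2 fun v hv => ?_
  have h0 : HasFDerivWithinAt f (0 : E →L[ℝ] ℝ) M x :=
    (hasFDerivWithinAt_const c x M).congr hM (hM x hx)
  simpa using h.hasFDerivWithinAt.unique_on h0 hv

/-- Two derivatives within `M` agree on the tangent cone, hence on its span. -/
lemma dOn_eq {M : Set E} {f : E → ℝ} {f' : E →L[ℝ] ℝ} {x : E} (h : HasFDerivWithinAt f f' M x) :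
    dOn M f x = f'.comp (tangent M x).subtypeL := by
  have h1 := h.differentiableWithinAt.hasFDerivWithinAt
  have h2 : tangent M x ≤ LinearMap.eqLocus (fderivWithin ℝ f M x : E →ₗ[ℝ] ℝ) (f' : E →ₗ[ℝ] ℝ) :=
    Submodule.span_le.2 fun v hv => h1.unique_on h hv
  ext ⟨v, hv⟩
  exact h2 hv

lemma hasFDerivWithinAt_of_eqOn {M U : Set E} {f g : E → ℝ} {x : E} (hU : IsOpen U) (hx : x ∈ M)
    (hxU : x ∈ U) (hg : ContDiff ℝ ∞ g) (hfg : ∀ y ∈ M ∩ U, g y = f y) :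
    HasFDerivWithinAt f (fderiv ℝ g x) M x := by
  have h1 : HasFDerivWithinAt g (fderiv ℝ g x) M x :=
    ((hg.differentiable (by simp)) x).hasFDerivAt.hasFDerivWithinAt
  refine h1.congr_of_eventuallyEq ?_ (hfg x ⟨hx, hxU⟩).symm
  filter_upwards [inter_mem_nhdsWithin M (hU.mem_nhds hxU)] with y hy using (hfg y hy).symm

/-- Makes the bracket on `M` computable from arbitrary local extensions of the two functions. -/
lemma bracketOn_eq {M U V : Set E} {P : BivectorField E} {Pt : BivectorFieldOn M}
    (hr : IsRestriction M P Pt) {f g f₁ g₁ : E → ℝ} {x : E} (hx : x ∈ M)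
    (hU : IsOpen U) (hxU : x ∈ U) (hf : ContDiff ℝ ∞ f₁) (hff : ∀ y ∈ M ∩ U, f₁ y = f y)
    (hV : IsOpen V) (hxV : x ∈ V) (hg : ContDiff ℝ ∞ g₁) (hgg : ∀ y ∈ M ∩ V, g₁ y = g y) :
    bracketOn M Pt f g x = bracket P f₁ g₁ x := by
  rw [bracketOn, dOn_eq (hasFDerivWithinAt_of_eqOn hU hx hxU hf hff),
    dOn_eq (hasFDerivWithinAt_of_eqOn hV hx hxV hg hgg)]
  simp [hr x hx, bracket]

variable [FiniteDimensional ℝ E]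

/-- A smooth function on `M` is locally the restriction of a globally smooth function. -/
lemma SmoothOn.exists_contDiff {M : Set E} {f : E → ℝ} (hf : SmoothOn M f) {x : E} (hx : x ∈ M) :
    ∃ U : Set E, IsOpen U ∧ x ∈ U ∧ ∃ g : E → ℝ, ContDiff ℝ ∞ g ∧ ∀ y ∈ M ∩ U, g y = f y := by
  obtain ⟨U, hU, hxU, g, hg, hfg⟩ := hf x hx
  have : HasContDiffBump E := inferInstance
  obtain ⟨r, hr, hrU⟩ := Metric.isOpen_iff.1 hU x hxU
  -- The bump is 1 on the ball of radius `r / 4` and 0 beyond `r / 2 < r`, so its product with `g`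
  -- is smooth even where `g` is not.
  let φ : ContDiffBump x := ⟨r / 4, r / 2, by positivity, by linarith⟩
  refine ⟨Metric.ball x (r / 4), Metric.isOpen_ball, Metric.mem_ball_self (by positivity),
    fun y => φ y * g y, ?_, ?_⟩
  · rw [contDiff_iff_contDiffAt]
    intro y
    by_cases hy : y ∈ Metric.ball x r
    · exact φ.contDiff.contDiffAt.mul (hg.contDiffAt (hU.mem_nhds (hrU hy)))
    · have hy' : (Metric.closedBall x (r / 2))ᶜ ∈ nhds y := by
        refine Metric.isClosed_closedBall.isOpen_compl.mem_nhds ?_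
        simp only [Metric.mem_ball, not_lt, Set.mem_compl_iff, Metric.mem_closedBall, not_le] at hy ⊢
        linarith
      refine (contDiffAt_const (c := (0 : ℝ))).congr_of_eventuallyEq ?_
      filter_upwards [hy'] with z hz
      simp only [Set.mem_compl_iff, Metric.mem_closedBall, not_le] at hz
      rw [φ.zero_of_le_dist hz.le, zero_mul]
  · rintro y ⟨hyM, hy⟩
    have h1 : φ y = 1 := φ.one_of_mem_closedBall (Metric.ball_subset_closedBall hy)
    have h2 : y ∈ U := hrU (Metric.ball_subset_ball (by linarith) hy)
    simp [h1, hfg y ⟨hyM, h2⟩]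

lemma exists_extend_form (S : Submodule ℝ E) (α : S →L[ℝ] ℝ) :
    ∃ β : E →L[ℝ] ℝ, β.comp S.subtypeL = α := by
  obtain ⟨p, hp⟩ := Submodule.ClosedComplemented.of_finiteDimensional S
  exact ⟨α.comp p, by ext v; simp [hp]⟩

/-- A skew field of bivectors tangent to `M` restricts to `M`. -/
theorem exists_isRestriction {M : Set E} {P : BivectorField E} (hs : IsSkew P)
    (hM : ∀ x ∈ M, ∀ α, P x α ∈ tangent M x) : ∃ Pt : BivectorFieldOn M, IsRestriction M P Pt := by
  classical
  choose p hp using fun x => Submodule.ClosedComplemented.of_finiteDimensional (tangent M x)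
  -- With `p` a projection onto the tangent space, the restriction is `p ∘ P ∘ p^*`.
  refine ⟨fun x => (p x).comp ((P x).comp ((ContinuousLinearMap.compL ℝ E (tangent M x) ℝ).flip
    (p x))), fun x hx α => ?_⟩
  -- The forms `α ∘ p` and `α` agree on tangent vectors. By skewness, `P` kills their difference,
  -- since every `P β` is tangent.
  have h0 : P x ((α.comp (tangent M x).subtypeL).comp (p x)) = P x α := by
    by_contra hne
    obtain ⟨β, hβ⟩ := SeparatingDual.exists_ne_zero (R := ℝ) (sub_ne_zero.2 hne)
    apply hβ
    rw [← map_sub, hs]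
    have h1 := hp x ⟨P x β, hM x hx β⟩
    simp [h1]
  have h1 := hp x ⟨P x α, hM x hx α⟩
  simp only [ContinuousLinearMap.comp_apply, ContinuousLinearMap.flip_apply,
    ContinuousLinearMap.compL_apply]
  rw [h0, h1]

/-- The ambient bracket of local extensions is itself a local extension of the bracket on `M`, so
iterated brackets, and with them the Jacobi identity, are inherited. -/
theorem IsPoisson.restrict {M : Set E} {P : BivectorField E} {Pt : BivectorFieldOn M}
    (hP : IsPoisson P) (hr : IsRestriction M P Pt) : IsPoissonOn M Pt where
  skew x hx α β := by
    obtain ⟨α, rfl⟩ := exists_extend_form _ α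
    obtain ⟨β, rfl⟩ := exists_extend_form _ β
    simpa [hr x hx] using hP.skew x α β
  smooth f g hf hg x hx := by
    obtain ⟨U, hU, hxU, f₁, hf₁, hff⟩ := hf.exists_contDiff hx
    obtain ⟨V, hV, hxV, g₁, hg₁, hgg⟩ := hg.exists_contDiff hx
    exact ⟨U ∩ V, hU.inter hV, ⟨hxU, hxV⟩, _, (hP.smooth f₁ g₁ hf₁ hg₁).contDiffOn,
      fun y hy => (bracketOn_eq hr hy.1 hU hy.2.1 hf₁ hff hV hy.2.2 hg₁ hgg).symm⟩
  jacobi f g h hf hg hh x hx := by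
    obtain ⟨U, hU, hxU, f₁, hf₁, hff⟩ := hf.exists_contDiff hx
    obtain ⟨V, hV, hxV, g₁, hg₁, hgg⟩ := hg.exists_contDiff hx
    obtain ⟨W, hW, hxW, h₁, hh₁, hhh⟩ := hh.exists_contDiff hx
    rw [bracketOn_eq hr hx hU hxU hf₁ hff (hV.inter hW) ⟨hxV, hxW⟩ (hP.smooth g₁ h₁ hg₁ hh₁)
        fun y hy => (bracketOn_eq hr hy.1 hV hy.2.1 hg₁ hgg hW hy.2.2 hh₁ hhh).symm,
      bracketOn_eq hr hx hV hxV hg₁ hgg (hW.inter hU) ⟨hxW, hxU⟩ (hP.smooth h₁ f₁ hh₁ hf₁)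
        fun y hy => (bracketOn_eq hr hy.1 hW hy.2.1 hh₁ hhh hU hy.2.2 hf₁ hff).symm,
      bracketOn_eq hr hx hW hxW hh₁ hhh (hU.inter hV) ⟨hxU, hxV⟩ (hP.smooth f₁ g₁ hf₁ hg₁)
        fun y hy => (bracketOn_eq hr hy.1 hU hy.2.1 hf₁ hff hV hy.2.2 hg₁ hgg).symm]
    exact hP.jacobi f₁ g₁ h₁ hf₁ hg₁ hh₁ x

theorem IsBiHamiltonian.restrict {M : Set E} {P Q : BivectorField E} {Pt Qt : BivectorFieldOn M}
    (h : IsBiHamiltonian P Q) (hP : IsRestriction M P Pt) (hQ : IsRestriction M Q Qt) :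
    IsBiHamiltonianOn M Pt Qt where
  left := h.left.restrict hP
  right := h.right.restrict hQ
  compatible c := (h.compatible c).restrict fun x hx α => by simp [hP x hx, hQ x hx]

theorem FRelated.projectsTo {F : E → E} {M : Set E} {Q P : BivectorField E}
    {Pt : BivectorFieldOn M} (hF : ContDiff ℝ ∞ F) (hM : Set.range F = M) (h : FRelated F Q P)
    (hr : IsRestriction M P Pt) : ProjectsTo F M Q Pt := by
  refine ⟨hF, hM, fun x => ⟨fun v => apply_mem_tangent
    ((hF.differentiable (by simp)) x).hasFDerivAt hM.le v, fun α => ?_⟩⟩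
  obtain ⟨α, rfl⟩ := exists_extend_form _ α
  rw [hr (F x) (hM ▸ Set.mem_range_self x), ← h x α]
  rfl

/-- Projection of a Hamiltonian vector field along `F`. -/
lemma ProjectsTo.apply_dOn {F : E → E} {M : Set E} {Q : BivectorField E}
    {Pt : BivectorFieldOn M} (h : ProjectsTo F M Q Pt) {f : E → ℝ} (hf : SmoothOn M f) (x : E) :
    (Pt (F x) (dOn M f (F x)) : E) = fderiv ℝ F x (Q x (fderiv ℝ (f ∘ F) x)) := by
  obtain ⟨hF, hM, hp⟩ := h
  obtain ⟨hFx, hP⟩ := hp x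
  have hxM : F x ∈ M := hM ▸ Set.mem_range_self x
  obtain ⟨U, hU, hxU, g, hg, hfg⟩ := hf.exists_contDiff hxM
  have h1 := hasFDerivWithinAt_of_eqOn hU hxM hxU hg hfg
  have h2 := h1.comp_hasFDerivAt x ((hF.differentiable (by simp)) x).hasFDerivAt
    (Filter.Eventually.of_forall fun z => hM ▸ Set.mem_range_self z)
  rw [h2.fderiv, dOn_eq h1, hP]
  rfl

end General

/-! ### Sums over the cycle and coordinates of forms. -/

section Cyclic

variable {n : ℕ} [NeZero n]

lemma sum_shift {M : Type*} [AddCommMonoid M] (f : Fin n → M) : ∑ i, f (i + 1) = ∑ i, f i :=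
  Equiv.sum_comp (Equiv.addRight (1 : Fin n)) f

lemma sum_shift_sub {M : Type*} [AddCommMonoid M] (f : Fin n → M) : ∑ i, f (i - 1) = ∑ i, f i :=
  Equiv.sum_comp (Equiv.subRight (1 : Fin n)) f

lemma sum_telescope (f : Fin n → ℝ) : ∑ i, (f (i + 1) - f i) = 0 := by
  rw [Finset.sum_sub_distrib, sum_shift, sub_self]

omit [NeZero n] in
/-- A form on the phase space in coordinates. -/
lemma form_apply (α : Phase n →L[ℝ] ℝ) (v : Phase n) :
    α v = ∑ i, (v.1 i * α (e₁ i) + v.2 i * α (e₂ i)) := by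
  have hv : v = ∑ i, (v.1 i • e₁ i + v.2 i • e₂ i) := by
    ext j <;>
      simp [e₁, e₂, Prod.fst_sum, Prod.snd_sum, Finset.sum_apply, Pi.single_apply]
  conv_lhs => rw [hv]
  simp

end Cyclic

/-! ### Smoothness and directional derivatives of operator fields. -/

section BivectorCalculus

variable {E : Type*} [NormedAddCommGroup E] [NormedSpace ℝ E]

lemma contDiff_wedge_left (w : E) : ContDiff ℝ ∞ (fun u : E => wedge u w) := by
  have : (fun u : E => wedge u w) = fun u =>
      ContinuousLinearMap.smulRightL ℝ (E →L[ℝ] ℝ) E (ContinuousLinearMap.apply ℝ ℝ u) w -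
      ContinuousLinearMap.smulRightL ℝ (E →L[ℝ] ℝ) E (ContinuousLinearMap.apply ℝ ℝ w) u := rfl
  rw [this]
  fun_prop

lemma contDiff_smul_wedge {f : E → ℝ} {u : E → E} (hf : ContDiff ℝ ∞ f) (hu : ContDiff ℝ ∞ u)
    (w : E) : ContDiff ℝ ∞ (fun x => f x • wedge (u x) w) :=
  hf.smul ((contDiff_wedge_left w).comp hu)

lemma contDiff_smul_add_smul {ι : Type*} [Fintype ι] {P Q : ι → BivectorField E} (s t : ℝ)
    (hP : ∀ i, ContDiff ℝ ∞ (P i)) (hQ : ∀ i, ContDiff ℝ ∞ (Q i)) :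
    ContDiff ℝ ∞ (fun y => s • ∑ i, P i y + t • ∑ i, Q i y) := by
  refine ContDiff.add (ContDiff.const_smul s ?_) (ContDiff.const_smul t ?_)
  · exact ContDiff.sum fun i _ => hP i
  · exact ContDiff.sum fun i _ => hQ i

/-- Reduces the derivative of an operator field to a scalar derivative along a line, where
coordinate formulas can be differentiated directly. -/
lemma hasDerivAt_line {F G : Type*} [NormedAddCommGroup F] [NormedSpace ℝ F]
    [NormedAddCommGroup G] [NormedSpace ℝ G] {P : E → F →L[ℝ] G} {y : E}
    (h : DifferentiableAt ℝ P y) (v : E) (β : F) (γ : G →L[ℝ] ℝ) :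
    HasDerivAt (fun r : ℝ => γ (P (y + r • v) β)) (γ (fderiv ℝ P y v β)) 0 := by
  have hline : HasDerivAt (fun r : ℝ => y + r • v) v 0 := by
    simpa using ((hasDerivAt_id (0 : ℝ)).smul_const v).const_add y
  have h1 : HasFDerivAt (fun x => γ (P x β))
      (γ.comp ((ContinuousLinearMap.apply ℝ G β).comp (fderiv ℝ P y))) y :=
    γ.hasFDerivAt.comp y ((ContinuousLinearMap.apply ℝ G β).hasFDerivAt.comp y h.hasFDerivAt)
  have h2 : y = y + (0 : ℝ) • v := by simp
  rw [h2] at h1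
  have h3 := h1.comp_hasDerivAt (0 : ℝ) hline
  rw [← h2] at h3
  exact h3

end BivectorCalculus

/-! ### The Poisson pencil in Flaschka coordinates. -/

section Pencil

variable {n : ℕ} [NeZero n]

/-- The pencil `s P₀ + t P₁`. -/
noncomputable def pencil (n : ℕ) [NeZero n] (s t : ℝ) : BivectorField (Phase n) :=
  fun y => s • P₀ n y + t • P₁ n y

/-- The pencil as a bivector on pairs of covectors, in coordinates. -/
lemma pencil_apply (s t : ℝ) (y : Phase n) (β γ : Phase n →L[ℝ] ℝ) :
    γ (pencil n s t y β) = ∑ i,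
      (t * (y.1 i * y.1 (i + 1)) * (β (e₁ i) * γ (e₁ (i + 1)) - β (e₁ (i + 1)) * γ (e₁ i))
      + y.1 i * (((s + t * y.2 i) * β (e₂ i) - (s + t * y.2 (i + 1)) * β (e₂ (i + 1))) * γ (e₁ i)
        - β (e₁ i) * ((s + t * y.2 i) * γ (e₂ i) - (s + t * y.2 (i + 1)) * γ (e₂ (i + 1))))
      + t * y.1 i * (β (e₂ (i + 1)) * γ (e₂ i) - β (e₂ i) * γ (e₂ (i + 1)))) := by
  simp only [pencil, P₀, P₁, add_apply, smul_apply,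
    sum_apply, map_add, map_smul, map_sum, wedge_apply, map_sub, smul_eq_mul,
    Finset.mul_sum, ← Finset.sum_add_distrib]
  exact Finset.sum_congr rfl fun i _ => by ring

lemma pencil_skew (s t : ℝ) : IsSkew (pencil n s t) := by
  intro y α β
  rw [pencil_apply, pencil_apply, ← Finset.sum_neg_distrib]
  exact Finset.sum_congr rfl fun i _ => by ring

/-- The coordinates of `P^♯ α`. -/
lemma pencil_fst (s t : ℝ) (y : Phase n) (α : Phase n →L[ℝ] ℝ) (i : Fin n) :
    (pencil n s t y α).1 i = y.1 i * (t * (y.1 (i - 1) * α (e₁ (i - 1))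
      - y.1 (i + 1) * α (e₁ (i + 1)))
      + (s + t * y.2 i) * α (e₂ i) - (s + t * y.2 (i + 1)) * α (e₂ (i + 1))) := by
  have h := pencil_apply s t y α (dq i)
  have h1 : ∀ j, dq i (e₁ j) = if i = j then 1 else 0 := fun j => by simp [dq, e₁, Pi.single_apply]
  have h2 : ∀ j, dq i (e₂ j) = 0 := fun j => by simp [dq, e₂]
  have h3 : ∀ j : Fin n, i = j + 1 ↔ i - 1 = j := fun j => sub_eq_iff_eq_add.symm
  simp only [h1, h2, h3, Finset.sum_add_distrib, mul_sub, Finset.sum_sub_distrib, mul_ite, mul_one,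
    mul_zero, Finset.sum_ite_eq, Finset.mem_univ, if_true, sub_add_cancel] at h
  refine Eq.trans ?_ (h.trans ?_)
  · rfl
  · simp; ring

lemma pencil_snd (s t : ℝ) (y : Phase n) (α : Phase n →L[ℝ] ℝ) (i : Fin n) :
    (pencil n s t y α).2 i = -(y.1 i * (s + t * y.2 i) * α (e₁ i))
      + y.1 (i - 1) * (s + t * y.2 i) * α (e₁ (i - 1))
      + t * (y.1 i * α (e₂ (i + 1)) - y.1 (i - 1) * α (e₂ (i - 1))) := by
  have h := pencil_apply s t y α (dp i)
  have h1 : ∀ j, dp i (e₂ j) = if i = j then 1 else 0 := fun j => by simp [dp, e₂, Pi.single_apply]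
  have h2 : ∀ j, dp i (e₁ j) = 0 := fun j => by simp [dp, e₁]
  have h3 : ∀ j : Fin n, i = j + 1 ↔ i - 1 = j := fun j => sub_eq_iff_eq_add.symm
  simp only [h1, h2, h3, Finset.sum_add_distrib, mul_sub, Finset.sum_sub_distrib, mul_ite, mul_one,
    mul_zero, Finset.sum_ite_eq, Finset.mem_univ, if_true, sub_add_cancel] at h
  refine Eq.trans ?_ (h.trans ?_)
  · rfl
  · simp; ring

lemma contDiff_pencil (s t : ℝ) : ContDiff ℝ ∞ (pencil n s t) := by
  have hq : ∀ i, ContDiff ℝ ∞ (fun y : Phase n => y.1 i) := fun i => (dq i).contDiff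
  have hp : ∀ i, ContDiff ℝ ∞ (fun y : Phase n => y.2 i) := fun i => (dp i).contDiff
  unfold pencil P₀ P₁
  refine contDiff_smul_add_smul s t (fun i => contDiff_smul_wedge (hq i) contDiff_const _)
    fun i => ((contDiff_smul_wedge ((hq i).mul (hq _)) contDiff_const _).add
      (contDiff_smul_wedge (hq i) ?_ _)).add (contDiff_smul_wedge (hq i) contDiff_const _)
  exact ((hp i).smul contDiff_const).sub ((hp _).smul contDiff_const)

lemma fderiv_pencil (s t : ℝ) (y v : Phase n) (β γ : Phase n →L[ℝ] ℝ) :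
    γ (fderiv ℝ (pencil n s t) y v β) = ∑ i,
      (t * (v.1 i * y.1 (i + 1) + y.1 i * v.1 (i + 1))
        * (β (e₁ i) * γ (e₁ (i + 1)) - β (e₁ (i + 1)) * γ (e₁ i))
      + v.1 i * (((s + t * y.2 i) * β (e₂ i) - (s + t * y.2 (i + 1)) * β (e₂ (i + 1))) * γ (e₁ i)
        - β (e₁ i) * ((s + t * y.2 i) * γ (e₂ i) - (s + t * y.2 (i + 1)) * γ (e₂ (i + 1))))
      + y.1 i * ((t * v.2 i * β (e₂ i) - t * v.2 (i + 1) * β (e₂ (i + 1))) * γ (e₁ i)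
        - β (e₁ i) * (t * v.2 i * γ (e₂ i) - t * v.2 (i + 1) * γ (e₂ (i + 1))))
      + t * v.1 i * (β (e₂ (i + 1)) * γ (e₂ i) - β (e₂ i) * γ (e₂ (i + 1)))) := by
  have h1 := hasDerivAt_line ((contDiff_pencil s t).differentiable (by simp) y) v β γ
  refine h1.unique ?_
  simp only [pencil_apply]
  refine HasDerivAt.fun_sum fun i _ => ?_
  have hc : ∀ a b : ℝ, HasDerivAt (fun r : ℝ => a + r * b) b 0 := fun a b => by
    simpa using ((hasDerivAt_id (0 : ℝ)).mul_const b).const_add a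
  have hq : ∀ j, HasDerivAt (fun r : ℝ => (y + r • v).1 j) (v.1 j) 0 := fun j => hc _ _
  have hp : ∀ j, HasDerivAt (fun r : ℝ => (y + r • v).2 j) (v.2 j) 0 := fun j => hc _ _
  have hu : ∀ j, HasDerivAt (fun r : ℝ => s + t * (y + r • v).2 j) (t * v.2 j) 0 := fun j =>
    ((hp j).const_mul t).const_add s
  have hw : ∀ δ : Phase n →L[ℝ] ℝ, HasDerivAt (fun r : ℝ => (s + t * (y + r • v).2 i) * δ (e₂ i)
      - (s + t * (y + r • v).2 (i + 1)) * δ (e₂ (i + 1)))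
      (t * v.2 i * δ (e₂ i) - t * v.2 (i + 1) * δ (e₂ (i + 1))) 0 := fun δ =>
    ((hu i).mul_const _).sub ((hu (i + 1)).mul_const _)
  have := ((((hq i).mul (hq (i + 1))).const_mul t).mul_const
      (β (e₁ i) * γ (e₁ (i + 1)) - β (e₁ (i + 1)) * γ (e₁ i))).add
    ((hq i).mul (((hw β).mul_const (γ (e₁ i))).sub ((hw γ).const_mul (β (e₁ i))))) |>.add
    (((hq i).const_mul t).mul_const (β (e₂ (i + 1)) * γ (e₂ i) - β (e₂ i) * γ (e₂ (i + 1))))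
  refine this.congr_deriv ?_
  simp
  ring

/-- The Jacobiator of the pencil is a sum of total differences. -/
lemma pencil_schouten (s t : ℝ) (y : Phase n) (α β γ : Phase n →L[ℝ] ℝ) :
    γ (fderiv ℝ (pencil n s t) y (pencil n s t y α) β)
      + α (fderiv ℝ (pencil n s t) y (pencil n s t y β) γ)
      + β (fderiv ℝ (pencil n s t) y (pencil n s t y γ) α) = 0 := by
  -- `D` is the trivector evaluation `(α ∧ β ∧ γ)(f, g, h)`, a determinant. `S` is the local
  -- potential whose cyclic difference is the summand of the Jacobiator.
  let D : Phase n → Phase n → Phase n → ℝ := fun f g h =>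
    α f * (β g * γ h - β h * γ g) + α g * (β h * γ f - β f * γ h) + α h * (β f * γ g - β g * γ f)
  let S : Fin n → ℝ := fun i => t * y.1 (i - 1) * y.1 i *
    (-(t * y.1 (i + 1) * D (e₁ (i - 1)) (e₁ i) (e₁ (i + 1)))
      + 2 * (s + t * y.2 i) * D (e₁ (i - 1)) (e₁ i) (e₂ i)
      - (s + t * y.2 (i + 1)) * D (e₁ (i - 1)) (e₁ i) (e₂ (i + 1))
      + t * D (e₁ (i - 1)) (e₂ i) (e₂ (i + 1)) + t * D (e₁ i) (e₂ (i - 1)) (e₂ i))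
  rw [fderiv_pencil, fderiv_pencil, fderiv_pencil, ← Finset.sum_add_distrib,
    ← Finset.sum_add_distrib, ← sum_telescope S]
  refine Finset.sum_congr rfl fun i _ => ?_
  simp only [pencil_fst, pencil_snd, S, D, add_sub_cancel_right]
  ring

/-- The parameters `(1, 0)`, `(0, 1)` and `(1, c)` give both structures and their compatibility. -/
theorem isPoisson_pencil (s t : ℝ) : IsPoisson (pencil n s t) :=
  isPoisson_of_schouten (pencil_skew s t) (contDiff_pencil s t) (pencil_schouten s t)

lemma pencil_one_zero : pencil n 1 0 = P₀ n := by
  funext y; simp [pencil]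

lemma pencil_zero_one : pencil n 0 1 = P₁ n := by
  funext y; simp [pencil]

theorem isBiHamiltonian : IsBiHamiltonian (P₀ n) (P₁ n) where
  left := pencil_one_zero (n := n) ▸ isPoisson_pencil 1 0
  right := pencil_zero_one (n := n) ▸ isPoisson_pencil 0 1
  compatible c := by
    have h : (fun x => P₀ n x + c • P₁ n x) = pencil n 1 c := by funext x; simp [pencil]
    exact h ▸ isPoisson_pencil 1 c

end Pencil

/-! ### The common Casimir function. -/

section Casimir

variable {n : ℕ} [NeZero n]

omit [NeZero n] in
lemma hasFDerivAt_casimir (y : Phase n) :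
    HasFDerivAt (casimir n) (∑ i, (∏ j ∈ Finset.univ.erase i, y.1 j) • dq i) y :=
  HasFDerivAt.finsetProd (g := fun (i : Fin n) (y : Phase n) => y.1 i) (g' := dq)
    fun i _ => (dq (n := n) i).hasFDerivAt

omit [NeZero n] in
-- Valid also where `a_i = 0`. In the coordinates of `P^♯ α` each `α (e₁ j)` carries the factor
-- `a_j`, so no division is needed.
lemma fderiv_casimir_e₁ (y : Phase n) (i : Fin n) :
    y.1 i * fderiv ℝ (casimir n) y (e₁ i) = casimir n y := by
  rw [(hasFDerivAt_casimir y).fderiv]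
  simp only [sum_apply, smul_apply, smul_eq_mul]
  rw [Finset.sum_eq_single i (fun j _ hj => by simp [dq, e₁, hj]) (by simp)]
  simp [dq, e₁, casimir, Finset.mul_prod_erase]

omit [NeZero n] in
lemma fderiv_casimir_e₂ (y : Phase n) (i : Fin n) : fderiv ℝ (casimir n) y (e₂ i) = 0 := by
  rw [(hasFDerivAt_casimir y).fderiv]
  simp [dq, e₂]

lemma pencil_casimir (s t : ℝ) (y : Phase n) : pencil n s t y (fderiv ℝ (casimir n) y) = 0 := by
  ext i
  · rw [pencil_fst, fderiv_casimir_e₁, fderiv_casimir_e₁, fderiv_casimir_e₂, fderiv_casimir_e₂]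
    simp
  · have h := fderiv_casimir_e₁ y i
    have h' := fderiv_casimir_e₁ y (i - 1)
    rw [pencil_snd, fderiv_casimir_e₂, fderiv_casimir_e₂]
    simp only [Prod.snd_zero, Pi.zero_apply]
    linear_combination (s + t * y.2 i) * (h' - h)

theorem casimir_spec (y : Phase n) :
    P₀ n y (fderiv ℝ (casimir n) y) = 0 ∧ P₁ n y (fderiv ℝ (casimir n) y) = 0 :=
  ⟨pencil_one_zero (n := n) ▸ pencil_casimir 1 0 y, pencil_zero_one (n := n) ▸ pencil_casimir 0 1 y⟩

end Casimir

/-! ### Wrap-around of indices and the sign kernel. -/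

section CyclicIndices

variable {n : ℕ} [NeZero n]

lemma val_add_one (i : Fin n) : ((i + 1 : Fin n) : ℕ) = if (i : ℕ) + 1 = n then 0 else (i : ℕ) + 1 := by
  rw [Fin.val_add, Fin.val_one', Nat.add_mod_mod]
  split_ifs with h
  · simp [h]
  · exact Nat.mod_eq_of_lt (by omega)

lemma eq_lastIndex_iff (i : Fin n) : i = lastIndex n ↔ (i : ℕ) + 1 = n := by
  have := NeZero.pos n
  rw [Fin.ext_iff]; simp only [lastIndex]; omega

lemma lastIndex_add_one : lastIndex n + 1 = 0 := by
  rw [Fin.ext_iff, val_add_one, if_pos ((eq_lastIndex_iff _).1 rfl), Fin.val_zero]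

lemma zero_sub_one_eq : (0 : Fin n) - 1 = lastIndex n := by
  rw [← lastIndex_add_one, add_sub_cancel_right]

/-- A cyclically constant function is constant. -/
lemma eq_zero_of_cyclic {g : Fin n → ℝ} (h : ∀ i, i ≠ lastIndex n → g (i + 1) = g i) (i : Fin n) :
    g i = g 0 := by
  obtain ⟨m, hm⟩ := i
  induction m with
  | zero => rfl
  | succ m ih =>
    have h1 : (⟨m, by omega⟩ : Fin n) ≠ lastIndex n := by
      rw [Ne, eq_lastIndex_iff]; simp only; omega
    have h2 : (⟨m, by omega⟩ : Fin n) + 1 = ⟨m + 1, hm⟩ := by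
      rw [Fin.ext_iff, val_add_one, if_neg (by simp only; omega)]
    rw [← ih (by omega), ← h _ h1, h2]

/-- The operator `w ↦ (∑_{j > i} w_j - ∑_{j < i} w_j)_i`. -/
def signSum (w : Fin n → ℝ) (i : Fin n) : ℝ :=
  ∑ j, ((if i < j then w j else 0) - (if j < i then w j else 0))

/-- Passing from `i` to `i + 1` only affects the terms `j = i` and `j = i + 1`, except from the last
index to the first, where the signs of the other terms flip; this produces the correction by the
total sum. -/
lemma signSum_sub (w : Fin n → ℝ) (i : Fin n) : signSum w i - signSum w (i + 1) =
    w i + w (i + 1) - if i = lastIndex n then 2 * ∑ j, w j else 0 := by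
  have key : ∀ j, ((if i < j then w j else 0) - (if j < i then w j else 0)) -
      ((if i + 1 < j then w j else 0) - (if j < i + 1 then w j else 0)) =
      (if i = j then w j else 0) + (if i + 1 = j then w j else 0)
        - (if i = lastIndex n then 2 * w j else 0) := by
    intro j
    simp only [Fin.lt_def, Fin.ext_iff (b := j), val_add_one, eq_lastIndex_iff]
    have hi := i.2
    have hj := j.2
    split_ifs <;> first | omega | ring
  rw [signSum, signSum, ← Finset.sum_sub_distrib, Finset.sum_congr rfl fun j _ => key j,
    Finset.sum_sub_distrib, Finset.sum_add_distrib]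
  simp only [Finset.sum_ite_eq, Finset.mem_univ, if_true]
  split_ifs <;> simp [Finset.mul_sum]

lemma signSum_zero (w : Fin n → ℝ) : signSum w 0 = ∑ j, w j - w 0 := by
  have key : ∀ j : Fin n, ((if 0 < j then w j else 0) - (if j < 0 then w j else 0)) =
      w j - if 0 = j then w j else 0 := by
    intro j
    rcases eq_or_ne 0 j with rfl | h
    · simp
    · simp [h, Fin.pos_iff_ne_zero, h.symm]
  rw [signSum, Finset.sum_congr rfl fun j _ => key j]
  simp

lemma signSum_last (w : Fin n → ℝ) : signSum w (lastIndex n) = w (lastIndex n) - ∑ j, w j := by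
  have h := signSum_sub w (lastIndex n)
  rw [lastIndex_add_one, signSum_zero, if_pos rfl] at h
  linarith

/-- `signSum` of a cyclic difference. -/
lemma signSum_diff (w : Fin n → ℝ) (i : Fin n) :
    signSum (fun j => w (j - 1) - w j) i = w i + w (i - 1) - 2 * w (lastIndex n) := by
  have hsum : ∑ j, (w (j - 1) - w j) = 0 := by
    rw [Finset.sum_sub_distrib, sum_shift_sub, sub_self]
  -- Since the differences sum to zero there is no wrap-around correction, so the two sides differ
  -- by a constant, which is read off at index 0.
  have h := eq_zero_of_cyclic (g := fun i => signSum (fun j => w (j - 1) - w j) i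
    - w i - w (i - 1)) (fun i _ => by
      have := signSum_sub (fun j => w (j - 1) - w j) i
      simp only [hsum, mul_zero, ite_self, add_sub_cancel_right] at this ⊢
      linarith) i
  simp only [signSum_zero, hsum, zero_sub_one_eq] at h
  linarith

omit [NeZero n] in
-- The sign kernel is antisymmetric; this is the nonlocal part of the skewness of `N_s π^♯`.
lemma sum_mul_signSum (v w : Fin n → ℝ) :
    ∑ i, v i * signSum w i = -∑ i, w i * signSum v i := by
  simp only [signSum, Finset.mul_sum]
  rw [Finset.sum_comm, ← Finset.sum_neg_distrib]
  refine Finset.sum_congr rfl fun i _ => ?_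
  rw [← Finset.sum_neg_distrib]
  refine Finset.sum_congr rfl fun j _ => ?_
  split_ifs <;> ring

omit [NeZero n] in
lemma signSum_fun_sub (v w : Fin n → ℝ) (i : Fin n) :
    signSum (fun j => v j - w j) i = signSum v i - signSum w i := by
  rw [signSum, signSum, signSum, ← Finset.sum_sub_distrib]
  refine Finset.sum_congr rfl fun j _ => ?_
  split_ifs <;> ring

end CyclicIndices

/-! ### The family `N_s` in coordinates and the skewness of `N_s π^♯`. -/

section RecursionOperator

variable {n : ℕ} [NeZero n]

/-- `N + s π^♯ Ω^♭`. -/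
noncomputable def twistedN (n : ℕ) [NeZero n] (s : ℝ) (x : Phase n) : Phase n →L[ℝ] Phase n :=
  openN n x + s • piOmega n x

lemma twistedN_one : twistedN n 1 = Nplus n := by
  funext x; simp [twistedN, Nplus]

lemma twistedN_neg_one : twistedN n (-1) = Nminus n := by
  funext x; simp [twistedN, Nminus, sub_eq_add_neg]

/-- The off-diagonal coefficients of `twistedN`. -/
noncomputable def coef (s : ℝ) (x : Phase n) (i : Fin n) : ℝ :=
  (if i = lastIndex n then -s else 1) * Real.exp (x.1 i - x.1 (i + 1))

omit [NeZero n] in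
lemma canonicalPi_apply (x : Phase n) (α : Phase n →L[ℝ] ℝ) :
    canonicalPi n x α = (fun i => α (e₂ i), fun i => -α (e₁ i)) := by
  ext i <;>
    simp [canonicalPi, wedge_apply, e₁, e₂, Prod.fst_sum, Prod.snd_sum, Finset.sum_apply,
      Pi.single_apply]

omit [NeZero n] in
lemma canonicalPi_skew : IsSkew (canonicalPi n) := by
  intro x α β
  rw [form_apply, form_apply α, canonicalPi_apply, canonicalPi_apply, ← Finset.sum_neg_distrib]
  exact Finset.sum_congr rfl fun i _ => by ring

lemma piOmega_apply (x : Phase n) (v : Phase n) : piOmega n x v =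
    Real.exp (x.1 (lastIndex n) - x.1 0) •
      (v.1 0 • e₂ (lastIndex n) - v.1 (lastIndex n) • e₂ (0 : Fin n)) := by
  have h : ∀ i j : Fin n, dq i (e₁ j) = if j = i then 1 else 0 := fun i j => by
    simp [dq, e₁, Pi.single_apply, eq_comm]
  ext i
  · simp [piOmega, omegaFlat, canonicalPi_apply, dq, e₂]
  · simp [piOmega, omegaFlat, canonicalPi_apply, dq, e₁, e₂, Pi.single_apply, eq_comm, -mul_eq_mul_left_iff]
    ring

omit [NeZero n] in
lemma openN_fst (x v : Phase n) (i : Fin n) :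
    (openN n x v).1 i = x.2 i * v.1 i + signSum v.2 i := by
  have h1 : ∀ a b : Fin n, ((if a < b then tens (e₁ a) (dp b) - tens (e₁ b) (dp a) else 0 :
      Phase n →L[ℝ] Phase n) v).1 i = (if i = a then (if i < b then v.2 b else 0) else 0)
        - if i = b then (if a < i then v.2 a else 0) else 0 := by
    intro a b
    by_cases hab : a < b
    · simp only [hab, if_true]
      simp only [tens, dp, e₁, sub_apply, ContinuousLinearMap.smulRight_apply,
        ContinuousLinearMap.comp_apply, ContinuousLinearMap.coe_snd', ContinuousLinearMap.proj_apply,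
        Prod.smul_mk, smul_zero, Prod.fst_sub, Pi.sub_apply, Pi.smul_apply, Pi.single_apply,
        smul_eq_mul, mul_ite, mul_one, mul_zero]
      congr 1
      · by_cases h : i = a
        · subst h; simp [hab]
        · simp [h]
      · by_cases h : i = b
        · subst h; simp [hab]
        · simp [h]
    · simp only [hab, if_false]
      by_cases h : i = a
      · subst h
        by_cases h' : i = b
        · subst h'; simp
        · simp [hab, h']
      · by_cases h' : i = b
        · subst h'; simp [hab]
        · simp [h, h']
  have h2 : ∀ a b : Fin n, ((if (a : ℕ) + 1 = (b : ℕ) then Real.exp (x.1 a - x.1 b) •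
      (tens (e₂ b) (dq a) - tens (e₂ a) (dq b)) else 0 : Phase n →L[ℝ] Phase n) v).1 i = 0 := by
    intro a b
    split_ifs <;> simp [tens, e₂]
  simp only [openN, add_apply, sum_apply, Prod.fst_add, Prod.fst_sum, Pi.add_apply,
    Finset.sum_apply, h1, h2, Finset.sum_const_zero, add_zero, Finset.sum_sub_distrib, signSum]
  congr 1
  · simp [tens, dq, dp, e₁, e₂, Pi.single_apply]
  · congr 1
    · rw [Finset.sum_comm]; simp
    · simp

lemma openN_snd (x v : Phase n) (i : Fin n) :
    (openN n x v).2 i = x.2 i * v.2 i + coef 0 x (i - 1) * v.1 (i - 1) - coef 0 x i * v.1 (i + 1) := by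
  have h1 : ∀ a b : Fin n, ((if a < b then tens (e₁ a) (dp b) - tens (e₁ b) (dp a) else 0 :
      Phase n →L[ℝ] Phase n) v).2 i = 0 := by
    intro a b
    split_ifs <;> simp [tens, e₁]
  -- `coef 0` vanishes at the last index, so the condition on natural numbers may be replaced by the
  -- cyclic one `a + 1 = b`.
  have h2 : ∀ a b : Fin n, ((if (a : ℕ) + 1 = (b : ℕ) then Real.exp (x.1 a - x.1 b) •
      (tens (e₂ b) (dq a) - tens (e₂ a) (dq b)) else 0 : Phase n →L[ℝ] Phase n) v).2 i =
      if a + 1 = b then coef 0 x a * ((if i - 1 = a then v.1 a else 0)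
        - if i = a then v.1 (a + 1) else 0) else 0 := by
    intro a b
    have hab : (a : ℕ) + 1 = b ↔ a + 1 = b ∧ a ≠ lastIndex n := by
      rw [Fin.ext_iff, val_add_one, Ne, eq_lastIndex_iff]
      have := b.2
      split_ifs <;> omega
    simp only [hab]
    by_cases hl : a = lastIndex n
    · simp [hl, coef]
    · by_cases h : a + 1 = b
      · subst h
        simp [hl, coef, tens, dq, e₂, Pi.single_apply, sub_eq_iff_eq_add]
      · simp [h]
  simp only [openN, add_apply, sum_apply, Prod.snd_add, Prod.snd_sum, Pi.add_apply,
    Finset.sum_apply, h1, h2, Finset.sum_const_zero, add_zero, add_sub_assoc]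
  congr 1
  · simp [tens, dq, dp, e₁, e₂, Pi.single_apply]
  · simp [mul_sub, Finset.sum_sub_distrib]

lemma twistedN_fst (s : ℝ) (x v : Phase n) (i : Fin n) :
    (twistedN n s x v).1 i = x.2 i * v.1 i + signSum v.2 i := by
  simp [twistedN, openN_fst, piOmega_apply, e₂]

/-- `π^♯ Ω^♭` closes the open chain: it contributes exactly the link between the last index and the
first. -/
lemma twistedN_snd (s : ℝ) (x v : Phase n) (i : Fin n) :
    (twistedN n s x v).2 i =
      x.2 i * v.2 i + coef s x (i - 1) * v.1 (i - 1) - coef s x i * v.1 (i + 1) := by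
  have h1 : ∀ j, coef s x j = coef 0 x j
      - if j = lastIndex n then s * Real.exp (x.1 (lastIndex n) - x.1 0) else 0 := by
    intro j
    by_cases hj : j = lastIndex n
    · subst hj; simp [coef, lastIndex_add_one]
    · simp [coef, hj]
  have h2 : i - 1 = lastIndex n ↔ i = 0 := by rw [sub_eq_iff_eq_add, lastIndex_add_one]
  rw [h1 i, h1 (i - 1)]
  simp only [h2]
  simp only [twistedN, add_apply, smul_apply, Prod.snd_add, Prod.smul_snd, Pi.add_apply,
    Pi.smul_apply, openN_snd, piOmega_apply, smul_eq_mul, Prod.snd_sub, Pi.sub_apply, e₂,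
    Pi.single_apply]
  -- The first and last indices coincide when `n = 1`, so all four combinations are treated.
  by_cases hi : i = 0
  · subst hi
    by_cases hl : (0 : Fin n) = lastIndex n
    · rw [if_pos rfl, if_pos hl, if_pos hl, if_pos rfl, zero_sub_one_eq, ← hl, hl, lastIndex_add_one,
        ← hl]
      ring
    · rw [if_pos rfl, if_neg hl, if_neg hl, if_pos rfl, zero_sub_one_eq]
      ring
  · by_cases hl : i = lastIndex n
    · subst hl
      rw [if_pos rfl, if_pos rfl, if_neg hi, if_neg hi, lastIndex_add_one]
      ring
    · rw [if_neg hl, if_neg hl, if_neg hi, if_neg hi]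
      ring

/-- `N_s π^♯` is skew-symmetric. -/
lemma twistedN_skew (s : ℝ) :
    IsSkew (fun x => (twistedN n s x).comp (canonicalPi n x)) := by
  intro x α β
  -- Three parts, each visibly skew: the diagonal, the sign kernel, and the nearest-neighbour terms
  -- after a cyclic shift.
  have h : ∀ α β : Phase n →L[ℝ] ℝ, β ((twistedN n s x).comp (canonicalPi n x) α) =
      ∑ i, (x.2 i * (α (e₂ i) * β (e₁ i) - α (e₁ i) * β (e₂ i)))
      - ∑ i, β (e₁ i) * signSum (fun j => α (e₁ j)) i
      + ∑ i, (coef s x i * (α (e₂ i) * β (e₂ (i + 1)) - α (e₂ (i + 1)) * β (e₂ i))) := by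
    intro α β
    have h0 : ∀ i, signSum (fun j => -α (e₁ j)) i = -signSum (fun j => α (e₁ j)) i := fun i => by
      simp only [signSum, ← Finset.sum_neg_distrib]
      exact Finset.sum_congr rfl fun j _ => by split_ifs <;> ring
    have h1 := sum_shift_sub (fun i => coef s x i * (α (e₂ i) * β (e₂ (i + 1))))
    simp only [sub_add_cancel] at h1
    rw [form_apply, ContinuousLinearMap.comp_apply]
    simp only [twistedN_fst, twistedN_snd, canonicalPi_apply, h0]
    simp only [mul_sub, Finset.sum_sub_distrib] at *
    rw [← h1]
    simp only [← Finset.sum_sub_distrib, ← Finset.sum_add_distrib]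
    exact Finset.sum_congr rfl fun i _ => by ring
  rw [h, h, sum_mul_signSum]
  have h2 := Finset.sum_neg_distrib (f := fun i =>
    x.2 i * (β (e₂ i) * α (e₁ i) - β (e₁ i) * α (e₂ i))) (s := Finset.univ)
  have h3 := Finset.sum_neg_distrib (f := fun i =>
    coef s x i * (β (e₂ i) * α (e₂ (i + 1)) - β (e₂ (i + 1)) * α (e₂ i))) (s := Finset.univ)
  have h4 : ∀ a b c : ℝ, -(a - b + c) = -a + b + -c := fun a b c => by ring
  rw [h4, ← h2, ← h3, sub_neg_eq_add]
  congr 1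
  · congr 1
    exact Finset.sum_congr rfl fun i _ => by ring
  · exact Finset.sum_congr rfl fun i _ => by ring

theorem piNminus_skew : IsSkew (piNminus n) := by
  have h := twistedN_skew (n := n) (-1)
  rwa [twistedN_neg_one] at h

end RecursionOperator

/-! ### The Flaschka map relates the two pairs of bivectors. -/

section Flaschka

variable {n : ℕ} [NeZero n]

/-- The differential of the Flaschka map. -/
noncomputable def flaschkaDeriv (x : Phase n) : Phase n →L[ℝ] Phase n :=
  (ContinuousLinearMap.pi fun i => (flaschka n x).1 i • (dq i - dq (i + 1))).prod
    (ContinuousLinearMap.snd ℝ _ _)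

lemma hasFDerivAt_flaschka (x : Phase n) :
    HasFDerivAt (flaschka n) (flaschkaDeriv x) x := by
  refine HasFDerivAt.prodMk (hasFDerivAt_pi.2 fun i => ?_) hasFDerivAt_snd
  have h : HasFDerivAt (fun x : Phase n => x.1 i - x.1 (i + 1)) (dq i - dq (i + 1)) x :=
    (dq i).hasFDerivAt.sub (dq (i + 1)).hasFDerivAt
  refine h.exp.neg.congr_fderiv ?_
  simp [flaschka]

lemma flaschkaDeriv_fst (x v : Phase n) (i : Fin n) :
    (flaschkaDeriv x v).1 i = (flaschka n x).1 i * (v.1 i - v.1 (i + 1)) := rfl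

lemma flaschkaDeriv_snd (x v : Phase n) : (flaschkaDeriv x v).2 = v.2 := rfl

lemma contDiff_flaschka : ContDiff ℝ ∞ (flaschka n) := by
  have hq : ∀ i, ContDiff ℝ ∞ (fun y : Phase n => y.1 i) := fun i => (dq i).contDiff
  refine ContDiff.prodMk (contDiff_pi.2 fun i => ?_) contDiff_snd
  exact (((hq i).sub (hq (i + 1))).exp).neg

lemma comp_flaschkaDeriv_e₁ (x : Phase n) (α : Phase n →L[ℝ] ℝ) (i : Fin n) :
    α (flaschkaDeriv x (e₁ i)) =
      (flaschka n x).1 i * α (e₁ i) - (flaschka n x).1 (i - 1) * α (e₁ (i - 1)) := by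
  have h : flaschkaDeriv x (e₁ i) =
      (flaschka n x).1 i • e₁ i - (flaschka n x).1 (i - 1) • e₁ (i - 1) := by
    ext j
    · by_cases h1 : j = i <;> by_cases h2 : j + 1 = i
      · have h3 : j - 1 = j := by rw [sub_eq_iff_eq_add, h2, h1]
        subst h1; simp [flaschkaDeriv_fst, e₁, h2, h3]
      · subst h1; simp [flaschkaDeriv_fst, e₁, h2, eq_sub_iff_add_eq]
      · subst h2; simp [flaschkaDeriv_fst, e₁, h1]
      · simp [flaschkaDeriv_fst, e₁, h1, h2, eq_sub_iff_add_eq]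
    · simp [flaschkaDeriv_snd, e₁]
  rw [h]; simp

lemma flaschkaDeriv_e₂ (x : Phase n) (i : Fin n) : flaschkaDeriv x (e₂ i) = e₂ i := by
  ext j
  · simp [flaschkaDeriv_fst, e₂]
  · simp [flaschkaDeriv_snd]

theorem fRelated_canonicalPi : FRelated (flaschka n) (canonicalPi n) (P₀ n) := by
  intro x α
  rw [(hasFDerivAt_flaschka x).fderiv, ← pencil_one_zero]
  ext i
  · simp only [flaschkaDeriv_fst, canonicalPi_apply, ContinuousLinearMap.comp_apply,
      flaschkaDeriv_e₂, pencil_fst]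
    ring
  · simp only [flaschkaDeriv_snd, canonicalPi_apply, ContinuousLinearMap.comp_apply,
      comp_flaschkaDeriv_e₁, pencil_snd]
    ring

/-- Only for `s = -1` does the closing link have the same sign as the others; this is why `N_-` is
the operator that projects. -/
lemma coef_neg_one (x : Phase n) (i : Fin n) : coef (-1) x i = -(flaschka n x).1 i := by
  simp [coef, flaschka]

theorem fRelated_piNminus : FRelated (flaschka n) (piNminus n) (P₁ n) := by
  intro x α
  rw [(hasFDerivAt_flaschka x).fderiv, ← pencil_zero_one, piNminus, ← twistedN_neg_one]
  ext i
  · have h := signSum_sub (fun j => -((flaschka n x).1 j * α (e₁ j)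
      - (flaschka n x).1 (j - 1) * α (e₁ (j - 1)))) i
    -- The `p`-part of `π^♯ F^* α` is a cyclic difference, so the wrap-around correction of
    -- `signSum_sub` vanishes and the nonlocal kernel becomes local.
    have h0 : ∑ j, -((flaschka n x).1 j * α (e₁ j)
        - (flaschka n x).1 (j - 1) * α (e₁ (j - 1))) = 0 := by
      rw [Finset.sum_neg_distrib, Finset.sum_sub_distrib,
        sum_shift_sub (fun j => (flaschka n x).1 j * α (e₁ j)), sub_self, neg_zero]
    rw [h0, add_sub_cancel_right, mul_zero, ite_self, sub_zero] at h
    simp only [flaschkaDeriv_fst, canonicalPi_apply, ContinuousLinearMap.comp_apply,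
      flaschkaDeriv_e₂, pencil_fst, twistedN_fst, comp_flaschkaDeriv_e₁]
    have h1 : (flaschka n x).2 = x.2 := rfl
    rw [h1]
    linear_combination (flaschka n x).1 i * h
  · simp only [flaschkaDeriv_snd, canonicalPi_apply, ContinuousLinearMap.comp_apply,
      flaschkaDeriv_e₂, pencil_snd, twistedN_snd, comp_flaschkaDeriv_e₁, coef_neg_one]
    have h1 : (flaschka n x).2 = x.2 := rfl
    rw [h1]
    ring

end Flaschka

/-! ### Traces on phase space. -/

section Trace

variable {n : ℕ}

/-- The trace as a continuous linear form. -/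
noncomputable def traceL (n : ℕ) : (Phase n →L[ℝ] Phase n) →L[ℝ] ℝ :=
  LinearMap.toContinuousLinearMap
    ((LinearMap.trace ℝ (Phase n)).comp (ContinuousLinearMap.coeLM ℝ))

lemma traceL_apply (A : Phase n →L[ℝ] Phase n) :
    traceL n A = LinearMap.trace ℝ (Phase n) (A : Phase n →ₗ[ℝ] Phase n) := rfl

lemma traceL_mul_comm (A B : Phase n →L[ℝ] Phase n) : traceL n (A * B) = traceL n (B * A) :=
  LinearMap.trace_mul_comm ℝ (A : Phase n →ₗ[ℝ] Phase n) (B : Phase n →ₗ[ℝ] Phase n)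

lemma traceL_mul_tens (A : Phase n →L[ℝ] Phase n) (u : Phase n) (α : Phase n →L[ℝ] ℝ) :
    traceL n (A * tens u α) = α (A u) := by
  have h : ((A * tens u α : Phase n →L[ℝ] Phase n) : Phase n →ₗ[ℝ] Phase n) =
      (α : Phase n →ₗ[ℝ] ℝ).smulRight (A u) := by
    ext v <;> simp [tens]
  rw [traceL_apply, h, LinearMap.trace_smulRight]
  rfl

lemma traceL_eq_sum (A : Phase n →L[ℝ] Phase n) :
    traceL n A = ∑ i, ((A (e₁ i)).1 i + (A (e₂ i)).2 i) := by
  have h : (1 : Phase n →L[ℝ] Phase n) = ∑ i, (tens (e₁ i) (dq i) + tens (e₂ i) (dp i)) := by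
    refine ContinuousLinearMap.ext fun v => ?_
    ext j <;> simp [tens, dq, dp, e₁, e₂, Prod.fst_sum, Prod.snd_sum, Finset.sum_apply,
      Pi.single_apply]
  conv_lhs => rw [← mul_one A, h]
  simp only [Finset.mul_sum, mul_add, map_sum, map_add, traceL_mul_tens]
  rfl

end Trace

/-! ### Derivatives of `N_s` and of the Hamiltonians. -/

section Derivative

variable {n : ℕ} [NeZero n]

lemma contDiff_twistedN (s : ℝ) : ContDiff ℝ ∞ (twistedN n s) := by
  have hq : ∀ i, ContDiff ℝ ∞ (fun y : Phase n => y.1 i) := fun i => (dq i).contDiff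
  have hp : ∀ i, ContDiff ℝ ∞ (fun y : Phase n => y.2 i) := fun i => (dp i).contDiff
  unfold twistedN openN piOmega canonicalPi omegaFlat
  refine ContDiff.add (ContDiff.add (ContDiff.add (ContDiff.sum fun i _ => ?_) contDiff_const)
    (ContDiff.sum fun i _ => ContDiff.sum fun j _ => ?_)) (ContDiff.const_smul s ?_)
  · exact (hp i).smul contDiff_const
  · split_ifs
    · exact ((hq i).sub (hq j)).exp.smul contDiff_const
    · exact contDiff_const
  · exact contDiff_const.clm_comp (((hq _).sub (hq _)).exp.smul contDiff_const)

lemma hasDerivAt_twistedN (s : ℝ) (x v w : Phase n) (γ : Phase n →L[ℝ] ℝ) :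
    HasDerivAt (fun r : ℝ => γ (twistedN n s (x + r • v) w))
      (γ (fderiv ℝ (twistedN n s) x v w)) 0 :=
  hasDerivAt_line ((contDiff_twistedN s).differentiable (by simp) x) v w γ

lemma hasDerivAt_coef (s : ℝ) (x v : Phase n) (i : Fin n) :
    HasDerivAt (fun r : ℝ => coef s (x + r • v) i) (coef s x i * (v.1 i - v.1 (i + 1))) 0 := by
  have hc : ∀ a b : ℝ, HasDerivAt (fun r : ℝ => a + r * b) b 0 := fun a b => by
    simpa using ((hasDerivAt_id (0 : ℝ)).mul_const b).const_add a
  have h : HasDerivAt (fun r : ℝ => (x + r • v).1 i - (x + r • v).1 (i + 1))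
      (v.1 i - v.1 (i + 1)) 0 := (hc _ _).sub (hc _ _)
  refine (h.exp.const_mul (if i = lastIndex n then -s else 1)).congr_deriv ?_
  simp [coef, mul_assoc]

lemma fderiv_twistedN_fst (s : ℝ) (x v w : Phase n) (i : Fin n) :
    (fderiv ℝ (twistedN n s) x v w).1 i = v.2 i * w.1 i := by
  refine (hasDerivAt_twistedN s x v w (dq i)).unique ?_
  have hc : ∀ a b : ℝ, HasDerivAt (fun r : ℝ => a + r * b) b 0 := fun a b => by
    simpa using ((hasDerivAt_id (0 : ℝ)).mul_const b).const_add a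
  have h : ∀ r : ℝ, dq i (twistedN n s (x + r • v) w) =
      (x.2 i + r * v.2 i) * w.1 i + signSum w.2 i := fun r => twistedN_fst s (x + r • v) w i
  simp only [h]
  exact ((hc _ _).mul_const _).add_const _

lemma fderiv_twistedN_snd (s : ℝ) (x v w : Phase n) (i : Fin n) :
    (fderiv ℝ (twistedN n s) x v w).2 i = v.2 i * w.2 i
      + coef s x (i - 1) * (v.1 (i - 1) - v.1 i) * w.1 (i - 1)
      - coef s x i * (v.1 i - v.1 (i + 1)) * w.1 (i + 1) := by
  refine (hasDerivAt_twistedN s x v w (dp i)).unique ?_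
  have hc : ∀ a b : ℝ, HasDerivAt (fun r : ℝ => a + r * b) b 0 := fun a b => by
    simpa using ((hasDerivAt_id (0 : ℝ)).mul_const b).const_add a
  have h : ∀ r : ℝ, dp i (twistedN n s (x + r • v) w) =
      (x.2 i + r * v.2 i) * w.2 i + coef s (x + r • v) (i - 1) * w.1 (i - 1)
        - coef s (x + r • v) i * w.1 (i + 1) := fun r => twistedN_snd s (x + r • v) w i
  simp only [h]
  have h1 := hasDerivAt_coef s x v (i - 1)
  rw [sub_add_cancel] at h1
  exact (((hc _ _).mul_const _).add (h1.mul_const _)).sub ((hasDerivAt_coef s x v i).mul_const _)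

/-- Needed because the image of `π^♯ Ω^♭` is spanned by momentum directions. -/
lemma fderiv_twistedN_e₂ (s : ℝ) (x : Phase n) (i : Fin n) :
    fderiv ℝ (twistedN n s) x (e₂ i) = tens (e₁ i) (dq i) + tens (e₂ i) (dp i) := by
  refine ContinuousLinearMap.ext fun w => ?_
  ext j
  · rw [fderiv_twistedN_fst]
    by_cases h : j = i
    · subst h; simp [tens, dq, dp, e₁, e₂]
    · simp [tens, dq, dp, e₁, e₂, h]
  · rw [fderiv_twistedN_snd]
    by_cases h : j = i
    · subst h; simp [tens, dq, dp, e₁, e₂]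
    · simp [tens, dq, dp, e₁, e₂, h]

/-- The 1-form `∑ dp_i`. -/
noncomputable def sumDp (n : ℕ) : Phase n →L[ℝ] ℝ := ∑ i, dp i

omit [NeZero n] in
lemma sumDp_apply (v : Phase n) : sumDp n v = ∑ i, v.2 i := by
  simp [sumDp, dp]

lemma traceL_fderiv_twistedN (s : ℝ) (x v : Phase n) :
    traceL n (fderiv ℝ (twistedN n s) x v) = 2 * sumDp n v := by
  rw [traceL_eq_sum, sumDp_apply, Finset.mul_sum]
  refine Finset.sum_congr rfl fun i _ => ?_
  rw [fderiv_twistedN_fst, fderiv_twistedN_snd]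
  simp [e₁, e₂]
  ring

lemma contDiff_Hplus (k : ℕ) : ContDiff ℝ ∞ (Hplus n k) := by
  have h : ContDiff ℝ ∞ (fun x : Phase n => 1 / (2 * (k : ℝ)) * traceL n (Nplus n x ^ k)) := by
    have h1 : ContDiff ℝ ∞ (Nplus n) := twistedN_one (n := n) ▸ contDiff_twistedN 1
    exact contDiff_const.mul ((traceL n).contDiff.comp (h1.pow k))
  exact h

/-- The product rule yields `k + 1` terms, all equal by cyclicity of the trace, which cancels the
normalisation of `H_{k+1}^+`. -/
lemma fderiv_Hplus (k : ℕ) (x v : Phase n) : fderiv ℝ (Hplus n (k + 1)) x v =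
    1 / 2 * traceL n (Nplus n x ^ k * fderiv ℝ (twistedN n 1) x v) := by
  have h0 : HasFDerivAt (twistedN n 1) (fderiv ℝ (twistedN n 1) x) x :=
    ((contDiff_twistedN 1).differentiable (by simp) x).hasFDerivAt
  have h1 := ((traceL n).hasFDerivAt.comp x (h0.pow' (k + 1))).const_mul
    (1 / (2 * ((k + 1 : ℕ) : ℝ)))
  have h2 : Hplus n (k + 1) = fun x => 1 / (2 * ((k + 1 : ℕ) : ℝ)) *
      (traceL n ∘ (twistedN n 1 ^ (k + 1))) x := by
    funext x; rw [twistedN_one]; rfl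
  rw [h2, h1.fderiv]
  simp only [smul_apply, ContinuousLinearMap.comp_apply, sum_apply, map_sum, smul_eq_mul]
  have h3 : ∀ i ∈ Finset.range (k + 1), traceL n (MulOpposite.op (twistedN n 1 x ^ i) •
      (twistedN n 1 x ^ ((k + 1).pred - i) * fderiv ℝ (twistedN n 1) x v)) =
      traceL n (Nplus n x ^ k * fderiv ℝ (twistedN n 1) x v) := by
    intro i hi
    have hi' : i + (k - i) = k := by have := Finset.mem_range.1 hi; omega
    rw [op_smul_eq_mul, traceL_mul_comm, ← mul_assoc, ← pow_add, Nat.pred_succ, hi',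
      twistedN_one]
  rw [Finset.sum_congr rfl h3]
  simp only [Finset.sum_const, Finset.card_range, nsmul_eq_mul]
  push_cast
  field_simp

lemma fderiv_Hplus_one (x : Phase n) : fderiv ℝ (Hplus n 1) x = sumDp n := by
  refine ContinuousLinearMap.ext fun v => ?_
  rw [fderiv_Hplus 0 x v, pow_zero, one_mul, traceL_fderiv_twistedN]
  ring

end Derivative

/-! ### Consequences of the skewness of `N_s^m π^♯`. -/

section Skew

variable {n : ℕ} [NeZero n]

/-- `π^♯ N_s^* = N_s π^♯` expresses that `π^♯` and `N_s π^♯` are both skew, as forms separate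
vectors. -/
lemma canonicalPi_comp (s : ℝ) (x : Phase n) (β : Phase n →L[ℝ] ℝ) :
    canonicalPi n x (β.comp (twistedN n s x)) = twistedN n s x (canonicalPi n x β) := by
  by_contra hne
  obtain ⟨α, hα⟩ := SeparatingDual.exists_ne_zero (R := ℝ) (sub_ne_zero.2 hne)
  apply hα
  rw [map_sub, canonicalPi_skew x (β.comp (twistedN n s x)) α]
  have h := twistedN_skew s x β α
  simp only [ContinuousLinearMap.comp_apply] at h ⊢
  linarith

lemma twistedN_pow_skew (s : ℝ) (x : Phase n) (m : ℕ) (α β : Phase n →L[ℝ] ℝ) :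
    β ((twistedN n s x ^ m) (canonicalPi n x α)) =
      -α ((twistedN n s x ^ m) (canonicalPi n x β)) := by
  induction m generalizing α β with
  | zero => exact canonicalPi_skew x α β
  | succ m ih =>
    have h := ih α (β.comp (twistedN n s x))
    rw [canonicalPi_comp] at h
    calc β ((twistedN n s x ^ (m + 1)) (canonicalPi n x α))
        = β (twistedN n s x ((twistedN n s x ^ m) (canonicalPi n x α))) := by rw [pow_succ']; rfl
      _ = -α ((twistedN n s x ^ m) (twistedN n s x (canonicalPi n x β))) := h
      _ = -α ((twistedN n s x ^ (m + 1)) (canonicalPi n x β)) := by rw [pow_succ]; rfl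

omit [NeZero n] in
lemma X₁_eq : X₁ n = ((fun _ => 1, 0) : Phase n) := by
  ext i <;> simp [X₁, e₁, Prod.fst_sum, Prod.snd_sum, Finset.sum_apply, Pi.single_apply]

omit [NeZero n] in
lemma canonicalPi_dq (x : Phase n) (i : Fin n) : canonicalPi n x (dq i) = -e₂ i := by
  rw [canonicalPi_apply]
  ext j <;> simp [dq, e₁, e₂, Pi.single_apply, eq_comm]

omit [NeZero n] in
lemma canonicalPi_dp (x : Phase n) (i : Fin n) : canonicalPi n x (dp i) = e₁ i := by
  rw [canonicalPi_apply]
  ext j <;> simp [dp, e₁, e₂, Pi.single_apply, eq_comm]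

omit [NeZero n] in
lemma canonicalPi_sumDp (x : Phase n) : canonicalPi n x (sumDp n) = X₁ n := by
  simp [sumDp, X₁, canonicalPi_dp]

/-- Skewness gives `dq_i (N_s^m π^♯ dq_i) = 0` for all `m`. At the two end indices `N_s^* dq_i` is
`p_i dq_i ± (∑ dp_j - dp_i)`, and applying `dq_i N_s^m π^♯` to it leaves only the difference of the
two sides. -/
lemma twistedN_pow_X₁ (s : ℝ) (x : Phase n) (m : ℕ) {i : Fin n} (hi : i = 0 ∨ i = lastIndex n) :
    dq i ((twistedN n s x ^ m) (X₁ n)) = dq i ((twistedN n s x ^ m) (e₁ i)) := by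
  have h0 : ∀ m, dq i ((twistedN n s x ^ m) (canonicalPi n x (dq i))) = 0 := fun m => by
    linarith [twistedN_pow_skew s x m (dq i) (dq i)]
  -- At an end of the chain the sign kernel has constant sign, so it reduces to a total sum; `ε` is
  -- that sign.
  obtain ⟨ε, hε, h⟩ : ∃ ε : ℝ, ε ≠ 0 ∧
      (dq i).comp (twistedN n s x) = x.2 i • dq i + ε • (sumDp n - dp i) := by
    rcases hi with rfl | rfl
    · refine ⟨1, one_ne_zero, ContinuousLinearMap.ext fun v => ?_⟩
      have := twistedN_fst s x v 0
      rw [signSum_zero] at this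
      simpa [dq, dp, sumDp_apply] using this
    · refine ⟨-1, by norm_num, ContinuousLinearMap.ext fun v => ?_⟩
      have := twistedN_fst s x v (lastIndex n)
      rw [signSum_last] at this
      simpa [dq, dp, sumDp_apply] using this
  have h1 := congrArg (fun u => dq i ((twistedN n s x ^ m) u))
    ((canonicalPi_comp s x (dq i)).symm.trans (congrArg (canonicalPi n x) h))
  have h2 := h0 (m + 1)
  rw [pow_succ, mul_apply_eq_comp] at h2
  simp only [h2, map_add, map_smul, map_sub, h0 m, canonicalPi_sumDp, canonicalPi_dp, smul_eq_mul,
    mul_zero, zero_add] at h1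
  have h3 := (mul_eq_zero.1 h1.symm).resolve_left hε
  linarith

/-- By skewness the two terms on each side are equal to one another, and `twistedN_pow_X₁` equates
the sides. The right side is the trace of `N_s^m` times the derivative of `N_s` along `∂_{p_i}`. -/
lemma sumDp_twistedN_pow (s : ℝ) (x : Phase n) (m : ℕ) {i : Fin n}
    (hi : i = 0 ∨ i = lastIndex n) :
    sumDp n ((twistedN n s x ^ m) (e₂ i)) + dq i ((twistedN n s x ^ m) (X₁ n)) =
      dq i ((twistedN n s x ^ m) (e₁ i)) + dp i ((twistedN n s x ^ m) (e₂ i)) := by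
  have h1 := twistedN_pow_skew s x m (dq i) (sumDp n)
  have h2 := twistedN_pow_skew s x m (dq i) (dp i)
  rw [canonicalPi_dq, canonicalPi_sumDp, map_neg, map_neg] at h1
  rw [canonicalPi_dq, canonicalPi_dp, map_neg, map_neg] at h2
  linarith [twistedN_pow_X₁ s x m hi]

end Skew

/-! ### The torsion of `N_+` and the generalized Lenard–Magri relations. -/

section LenardMagri

variable {n : ℕ} [NeZero n]

lemma piOmega_snd (x w : Phase n) (i : Fin n) : (piOmega n x w).2 i =
    (if i - 1 = lastIndex n then coef 1 x (i - 1) * w.1 (i - 1) else 0)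
      - if i = lastIndex n then coef 1 x i * w.1 (i + 1) else 0 := by
  have h := twistedN_snd 1 x w i
  have h' := twistedN_snd 0 x w i
  have h1 : (piOmega n x w).2 i = (twistedN n 1 x w).2 i - (twistedN n 0 x w).2 i := by
    simp [twistedN]
  rw [h1, h, h']
  simp only [coef]
  split_ifs <;> ring

/-- The torsion of `N_+`. -/
lemma torsion_twistedN (x v w : Phase n) :
    fderiv ℝ (twistedN n 1) x (twistedN n 1 x v) w - twistedN n 1 x (fderiv ℝ (twistedN n 1) x v w)
      - (fderiv ℝ (twistedN n 1) x (twistedN n 1 x w) v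
        - twistedN n 1 x (fderiv ℝ (twistedN n 1) x w v)) =
    (2 * (coef 1 x (lastIndex n) * (v.1 (lastIndex n) * w.1 0 - v.1 0 * w.1 (lastIndex n)))) • X₁ n
      - (2 : ℝ) • (sumDp n v • piOmega n x w - sumDp n w • piOmega n x v) := by
  ext i
  -- The antisymmetrised derivative of the exponentials is a cyclic difference; the end term in
  -- `signSum_diff` is the coefficient of `X₁`.
  · have h1 := signSum_diff (fun j => coef 1 x j * (v.1 j * w.1 (j + 1) - v.1 (j + 1) * w.1 j)) i
    have h2 := signSum_fun_sub (fderiv ℝ (twistedN n 1) x v w).2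
      (fderiv ℝ (twistedN n 1) x w v).2 i
    have h3 : (fun j => (fderiv ℝ (twistedN n 1) x v w).2 j
        - (fderiv ℝ (twistedN n 1) x w v).2 j) = fun j =>
        coef 1 x (j - 1) * (v.1 (j - 1) * w.1 (j - 1 + 1) - v.1 (j - 1 + 1) * w.1 (j - 1))
        - coef 1 x j * (v.1 j * w.1 (j + 1) - v.1 (j + 1) * w.1 j) := by
      funext j
      rw [fderiv_twistedN_snd, fderiv_twistedN_snd, sub_add_cancel]
      ring
    rw [h3, h1] at h2
    simp only [sub_add_cancel, lastIndex_add_one] at h2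
    simp only [Prod.fst_sub, Pi.sub_apply, fderiv_twistedN_fst, twistedN_fst, twistedN_snd, X₁_eq,
      Prod.smul_fst, Pi.smul_apply, smul_eq_mul, piOmega_apply, e₂, Pi.zero_apply]
    simp only [sub_zero, mul_zero, mul_one]
    linear_combination h2
  -- Here the total sums in `signSum_sub` at the wrap-around give the terms with `∑ dp_i`.
  · have h1 : ∀ u : Phase n, _ := fun u => signSum_sub u.2 i
    have h2 : ∀ u : Phase n, _ := fun u => signSum_sub u.2 (i - 1)
    simp only [sub_add_cancel] at h2
    simp only [Prod.snd_sub, Pi.sub_apply, fderiv_twistedN_fst, fderiv_twistedN_snd, twistedN_fst,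
      twistedN_snd, X₁_eq, Prod.smul_snd, Pi.smul_apply, smul_eq_mul, piOmega_snd, Pi.zero_apply,
      sumDp_apply, mul_zero]
    have a1 := h1 v
    have a2 := h2 v
    have a3 := h1 w
    have a4 := h2 w
    split_ifs at * with c1 c2 c2 <;>
    linear_combination coef 1 x (i - 1) * w.1 (i - 1) * a2 - coef 1 x i * w.1 (i + 1) * a1
      - coef 1 x (i - 1) * v.1 (i - 1) * a4 + coef 1 x i * v.1 (i + 1) * a3

/-- Trace of `N_+^k` times the torsion as an endomorphism of its second argument. The extra terms
are exactly `2 Tr (N_+^k D(π^♯ Ω^♭ v))`, with `D` the derivative of `N_+`, apart from the one in `∑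
dp_i (v)`; passing from `N_+ v` to `N_- v` subtracts them. -/
lemma traceL_recursion (k : ℕ) (x v : Phase n) :
    traceL n (Nplus n x ^ k * fderiv ℝ (twistedN n 1) x (Nminus n x v)) =
      traceL n (Nplus n x ^ (k + 1) * fderiv ℝ (twistedN n 1) x v)
        - 2 * traceL n (Nplus n x ^ k * piOmega n x) * sumDp n v := by
  rw [← twistedN_one]
  set R := twistedN n 1 x with hR
  set D := fderiv ℝ (twistedN n 1) x with hD
  set A : Phase n →L[ℝ] Phase n := D.flip v with hA
  set c := coef 1 x (lastIndex n) with hc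
  have hT : D (R v) - R * D v - (A * R - R * A) =
      tens (X₁ n) ((2 * c) • (v.1 (lastIndex n) • dq 0 - v.1 0 • dq (lastIndex n)))
      - (2 * sumDp n v) • piOmega n x + (2 : ℝ) • tens (piOmega n x v) (sumDp n) := by
    refine ContinuousLinearMap.ext fun w => ?_
    have h := torsion_twistedN x v w
    refine h.trans ?_
    simp only [tens, add_apply, sub_apply, smul_apply, ContinuousLinearMap.smulRight_apply, dq,
      ContinuousLinearMap.comp_apply, ContinuousLinearMap.proj_apply, ContinuousLinearMap.coe_fst',
      smul_eq_mul, ← hc]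
    module
  have h1 := congrArg (fun B => traceL n (R ^ k * B)) hT
  simp only [mul_add, mul_sub, map_add, map_sub, traceL_mul_tens, mul_smul_comm, map_smul,
    smul_eq_mul] at h1
  have h8 : ∀ u, ((2 * c) • (v.1 (lastIndex n) • dq 0 - v.1 0 • dq (lastIndex n)) :
      Phase n →L[ℝ] ℝ) u =
      2 * c * (v.1 (lastIndex n) * dq 0 u - v.1 0 * dq (lastIndex n) u) := fun u => rfl
  have h2 : traceL n (R ^ k * (A * R)) = traceL n (R ^ k * (R * A)) := by
    rw [← mul_assoc, traceL_mul_comm, ← mul_assoc, ← mul_assoc, ← pow_succ, ← pow_succ']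
  have h3 : Nminus n x v = R v - (2 : ℝ) • piOmega n x v := by
    simp only [hR, twistedN, Nminus, add_apply, sub_apply, smul_apply]
    module
  have h4 : piOmega n x v = c • (v.1 (lastIndex n) • e₂ 0 - v.1 0 • e₂ (lastIndex n)) := by
    rw [piOmega_apply, hc, coef, if_pos rfl, lastIndex_add_one]
    module
  have h5 : ∀ i, traceL n (R ^ k * D (e₂ i)) = dq i ((R ^ k) (e₁ i)) + dp i ((R ^ k) (e₂ i)) := by
    intro i
    rw [hD, fderiv_twistedN_e₂, mul_add, map_add, traceL_mul_tens, traceL_mul_tens]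
  have h6 : traceL n (R ^ k * D (piOmega n x v)) =
      c * (v.1 (lastIndex n) * (sumDp n ((R ^ k) (e₂ 0)) + dq 0 ((R ^ k) (X₁ n)))
        - v.1 0 * (sumDp n ((R ^ k) (e₂ (lastIndex n))) + dq (lastIndex n) ((R ^ k) (X₁ n)))) := by
    rw [sumDp_twistedN_pow 1 x k (Or.inl rfl), sumDp_twistedN_pow 1 x k (Or.inr rfl), ← h5, ← h5, h4]
    simp only [map_smul, map_sub, mul_smul_comm, mul_sub, smul_eq_mul]
  have h7 : sumDp n ((R ^ k) (piOmega n x v)) = c * (v.1 (lastIndex n) * sumDp n ((R ^ k) (e₂ 0))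
      - v.1 0 * sumDp n ((R ^ k) (e₂ (lastIndex n)))) := by
    rw [h4]; simp only [map_smul, map_sub, smul_eq_mul]
  rw [h3, map_sub, map_smul, mul_sub, mul_smul_comm, map_sub, map_smul, smul_eq_mul, h6, pow_succ,
    mul_assoc]
  rw [h2, h7, h8] at h1
  linear_combination h1

theorem lenardMagri {k : ℕ} (hk : 1 ≤ k) (x : Phase n) :
    (fderiv ℝ (Hplus n k) x).comp (Nminus n x) =
      fderiv ℝ (Hplus n (k + 1)) x + fcoef n k x • fderiv ℝ (Hplus n 1) x := by
  obtain ⟨k, rfl⟩ : ∃ m, k = m + 1 := ⟨k - 1, by omega⟩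
  refine ContinuousLinearMap.ext fun v => ?_
  have hf : fcoef n (k + 1) x = -traceL n (Nplus n x ^ k * piOmega n x) := rfl
  rw [fderiv_Hplus_one, ContinuousLinearMap.comp_apply, add_apply, smul_apply, fderiv_Hplus,
    fderiv_Hplus, traceL_recursion, hf, smul_eq_mul]
  ring

theorem canonicalPi_Hplus_one (x : Phase n) :
    canonicalPi n x (fderiv ℝ (Hplus n 1) x) = X₁ n := by
  rw [fderiv_Hplus_one, canonicalPi_sumDp]

theorem piNminus_Hplus {k : ℕ} (hk : 1 ≤ k) (x : Phase n) :
    piNminus n x (fderiv ℝ (Hplus n k) x) =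
      canonicalPi n x (fderiv ℝ (Hplus n (k + 1)) x) + fcoef n k x • X₁ n := by
  have h := canonicalPi_comp (-1) x (fderiv ℝ (Hplus n k) x)
  rw [twistedN_neg_one, lenardMagri hk, map_add, map_smul, canonicalPi_Hplus_one] at h
  exact h.symm

end LenardMagri

/-! ### Geometry of the level set and the reduced Hamiltonians. -/

section LevelSet

variable {n : ℕ} [NeZero n]

/-- The sums `∑_{j < i} w_j`. -/
def partialSum (w : Fin n → ℝ) (i : Fin n) : ℝ := ∑ j, if j < i then w j else 0

/-- Inverts the cyclic difference; the zero total makes it hold across the wrap-around too. It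
serves both the section of `F` and the linearised problem. -/
lemma partialSum_sub (w : Fin n → ℝ) (h : ∑ j, w j = 0) (i : Fin n) :
    partialSum w (i + 1) - partialSum w i = w i := by
  have key : ∀ j, (if j < i + 1 then w j else 0) - (if j < i then w j else 0) =
      (if i = j then w j else 0) - (if i = lastIndex n then w j else 0) := by
    intro j
    simp only [Fin.lt_def, Fin.ext_iff (b := j), val_add_one, eq_lastIndex_iff]
    have hi := i.2
    have hj := j.2
    split_ifs <;> first | omega | ring
  rw [partialSum, partialSum, ← Finset.sum_sub_distrib, Finset.sum_congr rfl fun j _ => key j,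
    Finset.sum_sub_distrib]
  split_ifs <;> simp [h]

lemma flaschka_mem (x : Phase n) : flaschka n x ∈ levelSet n := by
  refine ⟨?_, fun i => neg_neg_of_pos (Real.exp_pos _)⟩
  have h : ∑ i, (x.1 i - x.1 (i + 1)) = 0 := by
    rw [Finset.sum_sub_distrib, sum_shift, sub_self]
  simp only [casimir, flaschka]
  rw [Finset.prod_neg, ← Real.exp_sum, h]
  simp

lemma flaschka_ne_zero (x : Phase n) (i : Fin n) : (flaschka n x).1 i ≠ 0 :=
  ((flaschka_mem x).2 i).ne

/-- A section of the Flaschka map. -/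
noncomputable def flaschkaSection (y : Phase n) : Phase n :=
  (fun i => -partialSum (fun j => Real.log (-y.1 j)) i, y.2)

lemma flaschka_flaschkaSection {y : Phase n} (hy : y ∈ levelSet n) :
    flaschka n (flaschkaSection y) = y := by
  have hneg : ∀ i, 0 < -y.1 i := fun i => neg_pos.2 (hy.2 i)
  -- The product of the `-a_i` is `(-1)^n C = 1`.
  have h : ∑ i, Real.log (-y.1 i) = 0 := by
    rw [← Real.log_prod fun i _ => (hneg i).ne', Finset.prod_neg, ← casimir, hy.1]
    simp [← mul_pow]
  ext i
  · have h1 := partialSum_sub _ h i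
    simp only [flaschka, flaschkaSection]
    rw [neg_sub_neg, h1, Real.exp_log (hneg i), neg_neg]
  · rfl

theorem range_flaschka : Set.range (flaschka n) = levelSet n :=
  Set.Subset.antisymm (Set.range_subset_iff.2 flaschka_mem)
    fun y hy => ⟨flaschkaSection y, flaschka_flaschkaSection hy⟩

omit [NeZero n] in
lemma casimir_ne_zero {y : Phase n} (hy : y ∈ levelSet n) : casimir n y ≠ 0 := by
  rw [hy.1]; positivity

lemma fderiv_casimir_ne_zero {y : Phase n} (hy : y ∈ levelSet n) :
    fderiv ℝ (casimir n) y ≠ 0 := by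
  intro h
  have h1 := fderiv_casimir_e₁ y 0
  rw [h] at h1
  exact casimir_ne_zero hy (by simpa using h1.symm)

omit [NeZero n] in
lemma tangent_le_ker_casimir {y : Phase n} (hy : y ∈ levelSet n) :
    tangent (levelSet n) y ≤ LinearMap.ker (fderiv ℝ (casimir n) y : Phase n →ₗ[ℝ] ℝ) :=
  tangent_le_ker (hasFDerivAt_casimir y).differentiableAt.hasFDerivAt (fun _ h => h.1) hy

lemma range_flaschka_le_tangent (x : Phase n) :
    LinearMap.range (fderiv ℝ (flaschka n) x : Phase n →ₗ[ℝ] Phase n) ≤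
      tangent (levelSet n) (flaschka n x) := by
  rintro _ ⟨v, rfl⟩
  exact apply_mem_tangent (hasFDerivAt_flaschka x).differentiableAt.hasFDerivAt
    range_flaschka.le v

/-- Since `dC = C ∑ da_i / a_i` here, a vector in the kernel has logarithmic components of sum zero,
and their partial sums give a preimage. -/
lemma ker_casimir_le_range (x : Phase n) :
    LinearMap.ker (fderiv ℝ (casimir n) (flaschka n x) : Phase n →ₗ[ℝ] ℝ) ≤
      LinearMap.range (fderiv ℝ (flaschka n) x : Phase n →ₗ[ℝ] Phase n) := by
  intro v hv
  have hv' : fderiv ℝ (casimir n) (flaschka n x) v = 0 := hv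
  have hC := casimir_ne_zero (flaschka_mem x)
  have h : ∑ i, v.1 i / (flaschka n x).1 i = 0 := by
    rw [form_apply] at hv'
    refine (mul_eq_zero.1 ?_).resolve_left hC
    rw [← hv', Finset.mul_sum]
    refine Finset.sum_congr rfl fun i _ => ?_
    rw [fderiv_casimir_e₂, ← fderiv_casimir_e₁ _ i]
    field_simp [flaschka_ne_zero x i]
    ring
  refine ⟨(fun i => -partialSum (fun j => v.1 j / (flaschka n x).1 j) i, v.2), ?_⟩
  rw [(hasFDerivAt_flaschka x).fderiv]
  ext i
  · refine (flaschkaDeriv_fst x _ i).trans ?_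
    simp only
    rw [neg_sub_neg, partialSum_sub _ h, mul_div_cancel₀ _ (flaschka_ne_zero x i)]
  · rfl

/-- Closes the chain of inclusions through the image of `dF`, using that every point of the level
set is a value of `F`. -/
theorem tangent_levelSet {y : Phase n} (hy : y ∈ levelSet n) :
    tangent (levelSet n) y = LinearMap.ker (fderiv ℝ (casimir n) y : Phase n →ₗ[ℝ] ℝ) := by
  refine le_antisymm (tangent_le_ker_casimir hy) ?_
  rw [← flaschka_flaschkaSection hy]
  exact (ker_casimir_le_range _).trans (range_flaschka_le_tangent _)

theorem range_fderiv_flaschka (x : Phase n) :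
    LinearMap.range (fderiv ℝ (flaschka n) x : Phase n →ₗ[ℝ] Phase n) =
      tangent (levelSet n) (flaschka n x) :=
  le_antisymm (range_flaschka_le_tangent x)
    ((tangent_le_ker_casimir (flaschka_mem x)).trans (ker_casimir_le_range x))

/-- The differences `q_i - q_{i+1}` determine `q` up to a common translation, which is the flow of
`X₁`. -/
theorem flaschka_eq_iff (x y : Phase n) :
    flaschka n x = flaschka n y ↔ ∃ t : ℝ, y = x + t • X₁ n := by
  constructor
  · intro h
    refine ⟨y.1 0 - x.1 0, ?_⟩
    have h1 : ∀ i, x.1 i - x.1 (i + 1) = y.1 i - y.1 (i + 1) := fun i =>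
      Real.exp_injective (neg_injective (congrFun (congrArg (fun z : Phase n => z.1) h) i))
    have h2 : (flaschka n x).2 = (flaschka n y).2 := by rw [h]
    change x.2 = y.2 at h2
    ext i
    · have := eq_zero_of_cyclic (g := fun i => y.1 i - x.1 i) (fun i _ => by linarith [h1 i]) i
      simp [X₁_eq]
      linarith
    · simp [X₁_eq, h2]
  · rintro ⟨t, rfl⟩
    ext i <;> simp [flaschka, X₁_eq]

/-- `N_+` depends on `q` only through differences, so its traces descend along `F`. -/
lemma Nplus_add_smul_X₁ (x : Phase n) (t : ℝ) : Nplus n (x + t • X₁ n) = Nplus n x := by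
  simp [Nplus, openN, piOmega, omegaFlat, canonicalPi, X₁_eq]

/-- The reduced functions. -/
noncomputable def reducedH (n : ℕ) [NeZero n] (k : ℕ) (y : Phase n) : ℝ :=
  Hplus n k (flaschkaSection y)

lemma reducedH_flaschka (k : ℕ) (x : Phase n) : Hplus n k x = reducedH n k (flaschka n x) := by
  obtain ⟨t, ht⟩ := (flaschka_eq_iff x (flaschkaSection (flaschka n x))).1
    (flaschka_flaschkaSection (flaschka_mem x)).symm
  rw [reducedH, ht, Hplus, Hplus, Nplus_add_smul_X₁]

lemma smoothOn_reducedH (k : ℕ) : SmoothOn (levelSet n) (reducedH n k) := by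
  intro y hy
  have hq : ∀ i, ContDiff ℝ ∞ (fun y : Phase n => y.1 i) := fun i => (dq i).contDiff
  -- The logarithmic formula for the section is smooth on this whole open set, not only on the level
  -- set.
  refine ⟨{y | ∀ i, y.1 i < 0}, ?_, hy.2, reducedH n k, ?_, fun _ _ => rfl⟩
  · rw [Set.ofPred_forall]
    exact isOpen_iInter_of_finite fun i => isOpen_lt (hq i).continuous continuous_const
  · refine (contDiff_Hplus k).comp_contDiffOn (ContDiffOn.prodMk (contDiffOn_pi.2 fun i => ?_)
      contDiff_snd.contDiffOn)
    refine ContDiffOn.neg (ContDiffOn.sum fun j _ => ?_)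
    split_ifs
    · exact (hq j).neg.contDiffOn.log fun z hz => (neg_pos.2 (hz j)).ne'
    · exact contDiffOn_const

/-- By skewness `dC (P^♯ α) = -α (P^♯ dC) = 0`, so `P` is tangent to the level set. -/
lemma exists_restriction_levelSet {P : BivectorField (Phase n)} (hP : IsSkew P)
    (hC : ∀ y, P y (fderiv ℝ (casimir n) y) = 0) :
    ∃ Pt : BivectorFieldOn (levelSet n), IsRestriction (levelSet n) P Pt := by
  refine exists_isRestriction hP fun y hy α => ?_
  rw [tangent_levelSet hy]
  change fderiv ℝ (casimir n) y (P y α) = 0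
  rw [hP, hC, map_zero, neg_zero]

end LevelSet

end Toda

theorem mainTheorem4 (n : ℕ) [NeZero n] :
    -- `P₀`, `P₁` form a bi-Hamiltonian pair on `ℝ^{2n}` with common Casimir function `C`
    IsBiHamiltonian (P₀ n) (P₁ n) ∧
    (∀ y, P₀ n y (fderiv ℝ (casimir n) y) = 0 ∧ P₁ n y (fderiv ℝ (casimir n) y) = 0) ∧
    -- the level set is a regular hypersurface
    (∀ y ∈ levelSet n, fderiv ℝ (casimir n) y ≠ 0 ∧
      tangent (levelSet n) y = LinearMap.ker (fderiv ℝ (casimir n) y : Phase n →ₗ[ℝ] ℝ)) ∧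
    -- `F` is a submersion onto the level set, whose fibres are the integral curves of `X₁`
    Set.range (flaschka n) = levelSet n ∧
    (∀ x, LinearMap.range (fderiv ℝ (flaschka n) x : Phase n →ₗ[ℝ] Phase n) =
      tangent (levelSet n) (flaschka n x)) ∧
    (∀ x y, flaschka n x = flaschka n y ↔ ∃ t : ℝ, y = x + t • X₁ n) ∧
    -- `(π, π_{N_-})` is `F`-related to `(P₀, P₁)`
    IsSkew (piNminus n) ∧
    FRelated (flaschka n) (canonicalPi n) (P₀ n) ∧
    FRelated (flaschka n) (piNminus n) (P₁ n) ∧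
    -- the generalized Lenard-Magri chain of the `H_k^+` on `ℝ^{2n}`
    (∀ k, 1 ≤ k → ContDiff ℝ ∞ (Hplus n k)) ∧
    (∀ k, 1 ≤ k → ∀ x,
      (fderiv ℝ (Hplus n k) x).comp (Nminus n x) =
        fderiv ℝ (Hplus n (k + 1)) x + fcoef n k x • fderiv ℝ (Hplus n 1) x) ∧
    (∀ x, canonicalPi n x (fderiv ℝ (Hplus n 1) x) = X₁ n) ∧
    (∀ k, 1 ≤ k → ∀ x,
      piNminus n x (fderiv ℝ (Hplus n k) x) =
        canonicalPi n x (fderiv ℝ (Hplus n (k + 1)) x) + fcoef n k x • X₁ n) ∧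
    -- the restrictions of `P₀`, `P₁` to the level set, onto which `π`, `π_{N_-}` project
    ∃ Pt₀ Pt₁ : BivectorFieldOn (levelSet n),
      IsRestriction (levelSet n) (P₀ n) Pt₀ ∧
      IsRestriction (levelSet n) (P₁ n) Pt₁ ∧
      ProjectsTo (flaschka n) (levelSet n) (canonicalPi n) Pt₀ ∧
      ProjectsTo (flaschka n) (levelSet n) (piNminus n) Pt₁ ∧
      IsBiHamiltonianOn (levelSet n) Pt₀ Pt₁ ∧
      -- the reduced functions and their standard Lenard-Magri chain
      ∃ Ht : ℕ → Phase n → ℝ,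
        (∀ k, 1 ≤ k → SmoothOn (levelSet n) (Ht k) ∧ ∀ x, Hplus n k x = Ht k (flaschka n x)) ∧
        (∀ y ∈ levelSet n, Pt₀ y (dOn (levelSet n) (Ht 1) y) = 0) ∧
        (∀ k, 1 ≤ k → ∀ y ∈ levelSet n,
          Pt₁ y (dOn (levelSet n) (Ht k) y) = Pt₀ y (dOn (levelSet n) (Ht (k + 1)) y)) := by
  obtain ⟨Pt₀, h₀⟩ := exists_restriction_levelSet (n := n) isBiHamiltonian.left.skew
    fun y => (casimir_spec y).1
  obtain ⟨Pt₁, h₁⟩ := exists_restriction_levelSet (n := n) isBiHamiltonian.right.skew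
    fun y => (casimir_spec y).2
  have hp₀ := fRelated_canonicalPi.projectsTo contDiff_flaschka range_flaschka h₀
  have hp₁ := fRelated_piNminus.projectsTo contDiff_flaschka range_flaschka h₁
  have hH : ∀ k, reducedH n k ∘ flaschka n = Hplus n k := fun k =>
    funext fun x => (reducedH_flaschka k x).symm
  -- This removes `f_k X₁` under projection and turns the generalized relations into the standard
  -- ones.
  have hX : ∀ x, fderiv ℝ (flaschka n) x (X₁ n) = 0 := fun x => by
    rw [(hasFDerivAt_flaschka x).fderiv]
    ext i
    · simp [flaschkaDeriv_fst, X₁_eq]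
    · simp [flaschkaDeriv_snd, X₁_eq]
  refine ⟨isBiHamiltonian, casimir_spec,
    fun y hy => ⟨fderiv_casimir_ne_zero hy, tangent_levelSet hy⟩, range_flaschka,
    range_fderiv_flaschka, flaschka_eq_iff, piNminus_skew, fRelated_canonicalPi, fRelated_piNminus,
    fun k _ => contDiff_Hplus k, fun k hk => lenardMagri hk, canonicalPi_Hplus_one,
    fun k hk => piNminus_Hplus hk, Pt₀, Pt₁, h₀, h₁, hp₀, hp₁, isBiHamiltonian.restrict h₀ h₁,
    reducedH n, fun k _ => ⟨smoothOn_reducedH k, reducedH_flaschka k⟩, fun y hy => ?_,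
    fun k hk y hy => ?_⟩
  · rw [← range_flaschka] at hy
    obtain ⟨x, rfl⟩ := hy
    refine Subtype.ext ?_
    rw [hp₀.apply_dOn (smoothOn_reducedH 1), hH, canonicalPi_Hplus_one, hX]
    rfl
  · rw [← range_flaschka] at hy
    obtain ⟨x, rfl⟩ := hy
    refine Subtype.ext ?_
    rw [hp₀.apply_dOn (smoothOn_reducedH (k + 1)), hp₁.apply_dOn (smoothOn_reducedH k), hH, hH,
      piNminus_Hplus hk, map_add, map_smul, hX, smul_zero, add_zero]
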